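/- For a domain (nonempty connected open set) $D\subset\mathbb C^n$, possibly unbounded, and a weight $\phi$ on $D$, let $A^2_\phi(D)$ be the space of holomorphic $f:D\to\mathbb C$ with $\int_D|f|^2\phi\,dV<\infty$ ($dV$ is Lebesgue measure), and let $K_{D,\phi}(z,w)$ denote its reproducing kernel: $K_{D,\phi}(\cdot,w)\in A^2_\phi(D)$ for all $w\in D$, $K_{D,\phi}(z,w)=\overline{K_{D,\phi}(w,z)}$, and $f(z)=\int_D K_{D,\phi}(z,w)f(w)\phi(w)\,dV(w)$ for all $f\in A^2_\phi(D)$, $z\in D$. Write $K_D=K_{D,1}$ for the Bergman kernel, $K_D(z)=K_D(z,z)$, and, for an integer $d\ge0$, $K_{D,d}=K_{D,\phi}$ with $\phi(z)=K_D(z)^{-d}$, and $K_{D,d}(z)=K_{D,d}(z,z)$. **Proposition 4.1.** Let $d\ge 0$ be an integer and let $(D_j)$ be a sequence of domains in $\mathbb C^n$ converging to a domain $D\subset\mathbb C^n$ in the following way: (i) every compact subset of $D$ is contained in $D_j$ for all sufficiently large $j$; (ii) there is a point $q$ belonging to $D$ and to all $D_j$ such that for every $\varepsilon>0$ there is $j_\varepsilon$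 with $D_j-q\subset(1+\varepsilon)(D-q)$ for all $j\ge j_\varepsilon$. Assume further that $D$ is star-convex with respect to $q$, and that $K_D(z)\neq0$ and $K_{D,d}(z)\ne0$ for all $z\in D$. Then, for all sufficiently large $j$, $K_{D_j}$ does not vanish on the diagonal and the kernel $K_{D_j,d}$ exists and is $C^\infty$ on $D_j\times D_j$; the kernel $K_{D,d}$ is $C^\infty$ on $D\times D$; and $K_{D_j,d}\to K_{D,d}$ uniformly on compact subsets of $D\times D$, together with all partial derivatives of all orders (with respect to the real coordinates of $\mathbb C^n\times\mathbb C^n$). -/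

import Mathlib

open MeasureTheory Filter Topology
open scoped Pointwise ContDiff ComplexConjugate

/-- Membership in the weighted Bergman space `A²_φ(D)`, for `D ⊆ ℂⁿ` and a weight `φ` on `D`:
`f` is holomorphic on `D` and `∫_D |f|² φ dV < ∞`. Here `ℂⁿ` is `Fin n → ℂ`, whose `volume` is
Lebesgue measure. Only the values of `f` and `φ` on `D` matter. -/
def MemWeightedBergman {n : ℕ} (D : Set (Fin n → ℂ)) (φ : (Fin n → ℂ) → ℝ)
    (f : (Fin n → ℂ) → ℂ) : Prop :=
  DifferentiableOn ℂ f D ∧ IntegrableOn (fun z => ‖f z‖ ^ 2 * φ z) D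

/-- `K` is the reproducing kernel of `A²_φ(D)`: each `K(·, w)` lies in the space, `K` is
anti-symmetric, and `f(z) = ∫_D K(z, w) f(w) φ(w) dV(w)` for every `f` in the space. -/
structure IsReproducingKernel {n : ℕ} (D : Set (Fin n → ℂ)) (φ : (Fin n → ℂ) → ℝ)
    (K : (Fin n → ℂ) → (Fin n → ℂ) → ℂ) : Prop where
  mem : ∀ w ∈ D, MemWeightedBergman D φ (fun z => K z w)
  symm : ∀ z ∈ D, ∀ w ∈ D, K z w = conj (K w z)
  reproduces : ∀ f, MemWeightedBergman D φ f → ∀ z ∈ D,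
    f z = ∫ w in D, K z w * f w * (φ w : ℂ)

/-- The three properties determine the kernel on `D × D`. -/
theorem IsReproducingKernel.unique {n : ℕ} {D : Set (Fin n → ℂ)} {φ : (Fin n → ℂ) → ℝ}
    {K L : (Fin n → ℂ) → (Fin n → ℂ) → ℂ} (hD : MeasurableSet D)
    (hK : IsReproducingKernel D φ K) (hL : IsReproducingKernel D φ L) :
    ∀ z ∈ D, ∀ w ∈ D, K z w = L z w := by
  intro z hz w hw
  have h1 : K z w = ∫ u in D, L z u * K u w * (φ u : ℂ) :=
    hL.reproduces _ (hK.mem w hw) z hz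
  have h2 : L w z = ∫ u in D, K w u * L u z * (φ u : ℂ) :=
    hK.reproduces _ (hL.mem z hz) w hw
  rw [hL.symm z hz w hw, h2, h1, ← integral_conj]
  refine setIntegral_congr_fun hD fun u hu => ?_
  simp only [map_mul, Complex.conj_ofReal]
  rw [← hK.symm u hu w hw, ← hL.symm z hz u hu]
  ring

open Classical in
/-- The weighted Bergman kernel `K_{D,φ}(z, w)`, meaningful for `z, w ∈ D`: the reproducing kernel
of `A²_φ(D)` (and `0` by convention if that space has no reproducing kernel). -/
noncomputable def weightedBergmanKernel {n : ℕ} (D : Set (Fin n → ℂ)) (φ : (Fin n → ℂ) → ℝ) :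
    (Fin n → ℂ) → (Fin n → ℂ) → ℂ :=
  if h : ∃ K, IsReproducingKernel D φ K then h.choose else 0

/-- The Bergman kernel `K_D(z, w)`: the case of the weight `1`. -/
noncomputable def bergmanKernel {n : ℕ} (D : Set (Fin n → ℂ)) :
    (Fin n → ℂ) → (Fin n → ℂ) → ℂ :=
  weightedBergmanKernel D (fun _ => 1)

/-- The weight `K_D^{-d}`, where `K_D(z) = K_D(z, z)` (a real number by anti-symmetry). -/
noncomputable def bergmanWeight {n : ℕ} (D : Set (Fin n → ℂ)) (d : ℕ) (z : Fin n → ℂ) : ℝ :=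
  ((bergmanKernel D z z).re ^ d)⁻¹

/-- The weighted kernel of order `d`, `K_{D,d}(z, w)`: the reproducing kernel of
`A²_d(D) = A²_φ(D)` with `φ = K_D^{-d}`. -/
noncomputable def bergmanKernelOfOrder {n : ℕ} (D : Set (Fin n → ℂ)) (d : ℕ) :
    (Fin n → ℂ) → (Fin n → ℂ) → ℂ :=
  weightedBergmanKernel D (bergmanWeight D d)

/-! The driving principle is monotonicity: enlarging the domain and the weight decreases the
diagonal of the reproducing kernel, because `K(w, w)` is the best constant in `|f(w)|² ≤ C ‖f‖²`. A
quantitative form (`IsReproducingKernel.norm_sq_sub_le`) says that for `D' ⊆ D`, `φ' ≤ φ` one has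
`|K - K'|²(z, w) ≤ K'(z, z) (K'(w, w) - K(w, w))`, so control on the diagonal gives control
everywhere.

The kernels of `D_j` are squeezed between two comparisons. From inside, relatively compact open
subsets of `D` lie in `D_j` eventually, and their kernels approach that of `D` on the diagonal
(`tendsto_self_re_of_exhaustion`). From outside, `D_j` lies in the dilate of `D` of ratio `t > 1`,
whose kernel is explicit and tends to that of `D` as `t → 1`. This gives pointwise convergence
(`KernelConvergence.tendsto_kernel`). Since the kernels are holomorphic in `(z, w̄)` and locally
bounded uniformly in `j`, Cauchy's estimates upgrade it to locally uniform convergence of all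
derivatives.

For the weights `K_D^{-d}` the argument is run twice. The unweighted run makes `K_{D_j} → K_D`
uniform on compact sets, which bounds the weights of `D_j` from below there; monotonicity under
dilation bounds them from above on all of `D_j`. These are the weight hypotheses of
`KernelConvergence` for the second run. -/

/-! ### Cauchy estimates, Osgood's lemma and convergence of holomorphic maps -/

section SeveralComplexVariables

open Metric

variable {E F : Type} [NormedAddCommGroup E] [NormedSpace ℂ E]
  [NormedAddCommGroup F] [NormedSpace ℂ F]

/-- Cauchy's estimate for the Fréchet derivative of a holomorphic map. -/
theorem norm_fderiv_le_of_bound {f : E → F} {x : E} {r C : ℝ} (hr : 0 < r)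
    (hf : DifferentiableOn ℂ f (ball x r)) (hC : ∀ y ∈ ball x r, ‖f y‖ ≤ C) :
    ‖fderiv ℂ f x‖ ≤ C / r := by
  have hC0 : 0 ≤ C := (norm_nonneg _).trans (hC x (mem_ball_self hr))
  -- For `s < r` the closed disc of radius `s / ‖v‖` in the complex line `x + t v` stays in the
  -- ball, so the one-variable estimate applies; then `s → r`.
  have key : ∀ s, 0 < s → s < r → ‖fderiv ℂ f x‖ ≤ C / s := by
    intro s hs hsr
    refine ContinuousLinearMap.opNorm_le_bound _ (by positivity) fun v => ?_
    rcases eq_or_ne v 0 with rfl | hv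
    · simp
    have hv' : 0 < ‖v‖ := norm_pos_iff.2 hv
    have hmaps : ∀ t : ℂ, t ∈ closedBall (0 : ℂ) (s / ‖v‖) → x + t • v ∈ ball x r := by
      intro t ht
      rw [mem_closedBall_zero_iff, le_div_iff₀ hv'] at ht
      rw [mem_ball, dist_eq_norm, add_sub_cancel_left, norm_smul]
      exact ht.trans_lt hsr
    have hline : ∀ t : ℂ, HasDerivAt (fun t : ℂ => x + t • v) v t := fun t => by
      simpa using ((hasDerivAt_id t).smul_const v).const_add x
    have hdiff : ∀ t : ℂ, t ∈ closedBall (0 : ℂ) (s / ‖v‖) →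
        HasDerivAt (fun t : ℂ => f (x + t • v)) (fderiv ℂ f (x + t • v) v) t := fun t ht =>
      ((hf.differentiableAt (isOpen_ball.mem_nhds (hmaps t ht))).hasFDerivAt).comp_hasDerivAt t
        (hline t)
    have h1 := Complex.norm_deriv_le_of_forall_mem_sphere_norm_le (c := 0) (R := s / ‖v‖) (C := C)
      (f := fun t : ℂ => f (x + t • v)) (by positivity)
      (DifferentiableOn.diffContOnCl (fun t ht => (hdiff t
        (closure_ball_subset_closedBall ht)).differentiableAt.differentiableWithinAt))
      (fun t ht => hC _ (hmaps t (sphere_subset_closedBall ht)))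
    have h0 := (hdiff 0 (mem_closedBall_self (by positivity))).deriv
    rw [h0] at h1
    simp only [zero_smul, add_zero] at h1
    rwa [div_div_eq_mul_div, ← div_mul_eq_mul_div] at h1
  have hlim : Tendsto (fun s : ℝ => C / s) (𝓝[<] r) (𝓝 (C / r)) :=
    (tendsto_const_nhds.div tendsto_id hr.ne').mono_left nhdsWithin_le_nhds
  refine ge_of_tendsto hlim ?_
  filter_upwards [Ioo_mem_nhdsLT hr] with s hs using key s hs.1 hs.2

/-- A bounded holomorphic map on a ball is Lipschitz on the ball of half the radius. -/
theorem norm_sub_le_of_bound {f : E → F} {x : E} {r C : ℝ} (hr : 0 < r)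
    (hf : DifferentiableOn ℂ f (ball x (2 * r))) (hC : ∀ y ∈ ball x (2 * r), ‖f y‖ ≤ C)
    {y z : E} (hy : y ∈ ball x r) (hz : z ∈ ball x r) : ‖f z - f y‖ ≤ C / r * ‖z - y‖ := by
  let : NormedSpace ℝ E := NormedSpace.restrictScalars ℝ ℂ E
  have hsub : ∀ u ∈ ball x r, ball u r ⊆ ball x (2 * r) := fun u hu =>
    ball_subset_ball' (by rw [mem_ball] at hu; linarith)
  refine (convex_ball x r).norm_image_sub_le_of_norm_fderiv_le (𝕜 := ℂ) (fun u hu => ?_)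
    (fun u hu => ?_) hy hz
  · exact hf.differentiableAt (isOpen_ball.mem_nhds (hsub u hu (mem_ball_self hr)))
  · exact norm_fderiv_le_of_bound hr (hf.mono (hsub u hu)) fun v hv => hC v (hsub u hu hv)

theorem norm_fderiv_sub_fderiv_le_of_bound {f g : E → F} {x : E} {r C : ℝ} (hr : 0 < r)
    (hf : DifferentiableOn ℂ f (ball x r)) (hg : DifferentiableOn ℂ g (ball x r))
    (hC : ∀ y ∈ ball x r, ‖f y - g y‖ ≤ C) :
    ‖fderiv ℂ f x - fderiv ℂ g x‖ ≤ C / r := by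
  have hx := isOpen_ball.mem_nhds (mem_ball_self hr (x := x))
  have := norm_fderiv_le_of_bound (f := fun y => f y - g y) hr (hf.sub hg) hC
  rwa [fderiv_fun_sub (hf.differentiableAt hx) (hg.differentiableAt hx)] at this

/-- A uniform limit of holomorphic maps is holomorphic. -/
theorem differentiableAt_of_tendstoUniformlyOn_ball [CompleteSpace F] {ι : Type*} {l : Filter ι}
    [l.NeBot] {G : ι → E → F} {g : E → F} {x : E} {r : ℝ} (hr : 0 < r)
    (hG : ∀ᶠ n in l, DifferentiableOn ℂ (G n) (ball x r))
    (h : TendstoUniformlyOn G g l (ball x r)) : DifferentiableAt ℂ g x := by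
  have hsub : ∀ u ∈ ball x (r / 2), ball u (r / 2) ⊆ ball x r := fun u hu =>
    ball_subset_ball' (by rw [mem_ball] at hu; linarith)
  -- Cauchy's estimate for differences makes the derivatives uniformly Cauchy too, so limit and
  -- derivative may be interchanged.
  have hcau : UniformCauchySeqOn (fun n y => fderiv ℂ (G n) y) l (ball x (r / 2)) := by
    intro u hu
    obtain ⟨ε, hε, hεu⟩ := Metric.mem_uniformity_dist.1 hu
    have h1 := h.uniformCauchySeqOn _ (Metric.dist_mem_uniformity (show 0 < ε * (r / 4) by positivity))
    filter_upwards [h1, hG.prod_mk hG] with m hm hm' y hy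
    refine hεu ?_
    rw [dist_eq_norm]
    refine (norm_fderiv_sub_fderiv_le_of_bound (half_pos hr) (hm'.1.mono (hsub y hy))
      (hm'.2.mono (hsub y hy)) (C := ε * (r / 4)) fun z hz => ?_).trans_lt ?_
    · rw [← dist_eq_norm]
      exact (hm z (hsub y hy hz)).le
    · rw [div_lt_iff₀ (by positivity)]
      nlinarith [mul_pos hε hr]
  choose! g' hg' using fun y (hy : y ∈ ball x (r / 2)) =>
    cauchy_iff_exists_le_nhds.1 (hcau.cauchy_map hy)
  have hunif := hcau.tendstoUniformlyOn_of_tendsto (f := g') fun y hy => hg' y hy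
  have hx : ball x (r / 2) ∈ 𝓝 x := ball_mem_nhds _ (half_pos hr)
  refine (hasFDerivAt_of_tendstoUniformlyOnFilter (f := G) (g := g) (g' := g')
    (f' := fun n y => fderiv ℂ (G n) y) (l := l) ?_ ?_ ?_).differentiableAt
  · exact (tendstoUniformlyOn_iff_tendstoUniformlyOnFilter.1 hunif).mono_right (le_principal_iff.2 hx)
  · refine (hG.prod_mk hx).mono fun p hp => ?_
    exact (hp.1.differentiableAt (isOpen_ball.mem_nhds (ball_subset_ball (by linarith) hp.2))).hasFDerivAt
  · filter_upwards [hx] with y hy using h.tendsto_at (ball_subset_ball (by linarith) hy)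

/-- The existence of second derivatives is not presupposed: Cauchy's estimate is applied to `f(· +
(z - y)) - f`, which the Lipschitz bound makes of size `‖z - y‖`. -/
theorem norm_fderiv_sub_fderiv_le {f : E → F} {x : E} {r C : ℝ} (hr : 0 < r)
    (hf : DifferentiableOn ℂ f (ball x (4 * r))) (hC : ∀ y ∈ ball x (4 * r), ‖f y‖ ≤ C)
    {y z : E} (hy : y ∈ ball x r) (hz : z ∈ ball x r) :
    ‖fderiv ℂ f z - fderiv ℂ f y‖ ≤ C / (r * r) * 2 * ‖z - y‖ := by
  have hsub : ∀ u ∈ ball x r, ball u r ⊆ ball x (2 * r) := fun u hu =>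
    ball_subset_ball' (by rw [mem_ball] at hu; linarith)
  have hC0 : 0 ≤ C := (norm_nonneg _).trans (hC x (mem_ball_self (by positivity)))
  have hmem : ∀ u ∈ ball y r, u + (z - y) ∈ ball z r := fun u hu => by
    rw [mem_ball, dist_eq_norm] at hu ⊢
    rwa [show u + (z - y) - z = u - y by abel]
  have h2 : ball x (2 * r) ⊆ ball x (4 * r) := ball_subset_ball (by linarith)
  have key := norm_fderiv_sub_fderiv_le_of_bound (f := fun u => f (u + (z - y))) (g := f) (x := y)
    (C := C / (2 * r) * ‖z - y‖) hr
    (fun u hu => ((hf.differentiableAt (isOpen_ball.mem_nhds (h2 (hsub z hz (hmem u hu))))).comp u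
      (differentiableAt_id.add_const _)).differentiableWithinAt)
    (hf.mono ((hsub y hy).trans h2)) fun u hu => by
      have := norm_sub_le_of_bound (x := x) (r := 2 * r) (C := C) (by positivity)
        (by convert hf using 2; ring) (by convert hC using 4; ring) (hsub y hy hu)
        (hsub z hz (hmem u hu))
      simpa using this
  rw [fderiv_comp_add_right, add_sub_cancel] at key
  refine key.trans ?_
  have : 0 ≤ C * ‖z - y‖ := by positivity
  rw [div_mul_eq_mul_div, div_div, div_mul_eq_mul_div, div_mul_eq_mul_div,
    div_le_div_iff₀ (by positivity) (by positivity)]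
  nlinarith [mul_nonneg this (mul_self_nonneg r)]

/-- Directional derivatives of holomorphic maps are holomorphic. -/
theorem differentiableOn_fderiv_apply [CompleteSpace F] {f : E → F} {U : Set E} (hU : IsOpen U)
    (hf : DifferentiableOn ℂ f U) (v : E) : DifferentiableOn ℂ (fun x => fderiv ℂ f x v) U := by
  let : NormedSpace ℝ E := NormedSpace.restrictScalars ℝ ℂ E
  intro x hx
  refine DifferentiableAt.differentiableWithinAt ?_
  have hcont := (hf.differentiableAt (hU.mem_nhds hx)).continuousAt
  obtain ⟨R, hR, hRU⟩ := Metric.mem_nhds_iff.1 (Filter.inter_mem (hU.mem_nhds hx)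
    (hcont.norm.eventually_lt_const (lt_add_one ‖f x‖)))
  obtain ⟨r, hr, rfl⟩ : ∃ r, 0 < r ∧ R = 4 * r := ⟨R / 4, by positivity, by ring⟩
  set C := ‖f x‖ + 1
  have hfb : DifferentiableOn ℂ f (ball x (4 * r)) := hf.mono fun y hy => (hRU hy).1
  have hC : ∀ y ∈ ball x (4 * r), ‖f y‖ ≤ C := fun y hy => (hRU hy).2.le
  have hC0 : 0 ≤ C := by positivity
  have hsmall : ∀ᶠ t : ℂ in 𝓝[≠] 0, ‖t • v‖ < r / 2 := by
    have : Tendsto (fun t : ℂ => ‖t • v‖) (𝓝 0) (𝓝 0) := by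
      have : Continuous fun t : ℂ => ‖t • v‖ := by fun_prop
      simpa using this.tendsto 0
    exact (this.eventually_lt_const (half_pos hr)).filter_mono nhdsWithin_le_nhds
  have hsub : ∀ y ∈ ball x (r / 2), ∀ t : ℂ, ‖t • v‖ < r / 2 → y + t • v ∈ ball x r := by
    intro y hy t ht
    rw [mem_ball, dist_eq_norm] at hy ⊢
    calc ‖y + t • v - x‖ = ‖(y - x) + t • v‖ := by congr 1; abel
      _ ≤ _ := norm_add_le _ _
      _ < r := by linarith
  have hss : ball x r ⊆ ball x (4 * r) := ball_subset_ball (by linarith)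
  have hdf : ∀ y ∈ ball x (4 * r), DifferentiableAt ℂ f y := fun y hy =>
    hfb.differentiableAt (isOpen_ball.mem_nhds hy)
  -- The directional derivative is a uniform limit of its difference quotients, which are
  -- holomorphic; the error is controlled by the Lipschitz bound on `fderiv`.
  refine differentiableAt_of_tendstoUniformlyOn_ball (l := 𝓝[≠] (0 : ℂ)) (half_pos hr)
    (G := fun t y => t⁻¹ • (f (y + t • v) - f y)) ?_ ?_
  · filter_upwards [hsmall] with t ht y hy
    refine DifferentiableAt.differentiableWithinAt ?_
    exact (((hdf _ (hss (hsub y hy t ht))).comp y (differentiableAt_id.add_const _)).sub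
      (hdf _ (hss (ball_subset_ball (by linarith) hy)))).const_smul _
  · have hlim : Tendsto (fun t : ℂ => C / (r * r) * 2 * ‖t • v‖ * ‖v‖) (𝓝[≠] 0) (𝓝 0) := by
      have : Continuous fun t : ℂ => C / (r * r) * 2 * ‖t • v‖ * ‖v‖ := by fun_prop
      simpa using (this.tendsto 0).mono_left nhdsWithin_le_nhds
    rw [Metric.tendstoUniformlyOn_iff]
    intro ε hε
    filter_upwards [hsmall, self_mem_nhdsWithin, hlim.eventually_lt_const hε] with t ht ht0 htε y hy
    have ht0 : t ≠ 0 := ht0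
    have hyr : y ∈ ball x r := ball_subset_ball (by linarith) hy
    have hseg : segment ℝ y (y + t • v) ⊆ ball x r :=
      (convex_ball x r).segment_subset hyr (hsub y hy t ht)
    have := (convex_segment (𝕜 := ℝ) y (y + t • v)).norm_image_sub_le_of_norm_fderiv_le' (𝕜 := ℂ)
      (f := f) (φ := fderiv ℂ f y) (C := C / (r * r) * 2 * ‖t • v‖)
      (fun u hu => hdf u (hss (hseg hu))) (fun u hu => ?_) (left_mem_segment ℝ y (y + t • v))
      (right_mem_segment ℝ y (y + t • v))
    · rw [add_sub_cancel_left, map_smul] at this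
      rw [dist_comm, dist_eq_norm]
      have e : t⁻¹ • (f (y + t • v) - f y) - fderiv ℂ f y v
          = t⁻¹ • (f (y + t • v) - f y - t • fderiv ℂ f y v) := by
        rw [smul_sub t⁻¹ (f (y + t • v) - f y), inv_smul_smul₀ ht0]
      rw [e, norm_smul, norm_inv]
      refine lt_of_le_of_lt ?_ htε
      rw [inv_mul_le_iff₀ (norm_pos_iff.2 ht0)]
      refine this.trans (le_of_eq ?_)
      rw [norm_smul]; ring
    · refine (norm_fderiv_sub_fderiv_le hr hfb hC hyr (hseg hu)).trans ?_
      refine mul_le_mul_of_nonneg_left ?_ (by positivity)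
      have := norm_sub_le_of_mem_segment hu
      simpa using this

/-- Holomorphic maps on open subsets of finite-dimensional spaces are smooth. -/
theorem contDiffOn_of_differentiableOn_complex [FiniteDimensional ℂ E] [CompleteSpace F]
    {U : Set E} (hU : IsOpen U) {f : E → F} (hf : DifferentiableOn ℂ f U) :
    ContDiffOn ℂ ∞ f U := by
  rw [contDiffOn_infty]
  intro n
  induction n generalizing f with
  | zero => exact contDiffOn_zero.2 hf.continuousOn
  | succ n ih =>
    refine contDiffOn_succ_of_fderiv_apply hf (fun h => absurd h (WithTop.natCast_ne_top n)) fun v => ?_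
    refine (ih (differentiableOn_fderiv_apply hU hf v)).congr fun x hx => ?_
    rw [fderivWithin_of_isOpen hU hx]

variable {E' : Type} [NormedAddCommGroup E'] [NormedSpace ℂ E']

/-- Joint continuity of a partial derivative is what Osgood's lemma needs. Separate Lipschitz bounds
make `H(· + (z - a), w) - H(·, b)` small near `a`, and Cauchy's estimate passes this to the
derivatives. -/
theorem continuousAt_fderiv_left {H : E → E' → F} {a : E} {b : E'} {r C : ℝ} (hr : 0 < r)
    (h1 : ∀ w ∈ ball b (2 * r), DifferentiableOn ℂ (fun z => H z w) (ball a (2 * r)))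
    (h2 : ∀ z ∈ ball a (2 * r), DifferentiableOn ℂ (fun w => H z w) (ball b (2 * r)))
    (hC : ∀ z ∈ ball a (2 * r), ∀ w ∈ ball b (2 * r), ‖H z w‖ ≤ C) :
    ContinuousAt (fun p : E × E' => fderiv ℂ (fun z => H z p.2) p.1) (a, b) := by
  have hC0 : 0 ≤ C := (norm_nonneg _).trans
    (hC a (mem_ball_self (by positivity)) b (mem_ball_self (by positivity)))
  have h2r : ball a r ⊆ ball a (2 * r) := ball_subset_ball (by linarith)
  have h2r' : ball b r ⊆ ball b (2 * r) := ball_subset_ball (by linarith)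
  have hlim : Tendsto (fun p : E × E' => (C / r * ‖p.1 - a‖ + C / r * ‖p.2 - b‖) / (r / 2))
      (𝓝 (a, b)) (𝓝 0) := by
    have : Continuous fun p : E × E' => (C / r * ‖p.1 - a‖ + C / r * ‖p.2 - b‖) / (r / 2) := by
      fun_prop
    simpa using this.tendsto (a, b)
  rw [ContinuousAt, tendsto_iff_norm_sub_tendsto_zero]
  refine squeeze_zero' (Eventually.of_forall fun _ => norm_nonneg _) ?_ hlim
  have hnhds : ball a (r / 2) ×ˢ ball b r ∈ 𝓝 (a, b) :=
    prod_mem_nhds (ball_mem_nhds _ (half_pos hr)) (ball_mem_nhds _ hr)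
  filter_upwards [hnhds] with p hp
  obtain ⟨z, w⟩ := p
  obtain ⟨hz, hw⟩ : z ∈ ball a (r / 2) ∧ w ∈ ball b r := hp
  have hmem : ∀ u ∈ ball a (r / 2), u + (z - a) ∈ ball a r := fun u hu => by
    rw [mem_ball, dist_eq_norm] at hu hz ⊢
    calc ‖u + (z - a) - a‖ = ‖(u - a) + (z - a)‖ := by congr 1; abel
      _ ≤ _ := norm_add_le _ _
      _ < r := by linarith
  have hb : b ∈ ball b r := mem_ball_self hr
  have hhalf : ball a (r / 2) ⊆ ball a r := ball_subset_ball (by linarith)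
  have key := norm_fderiv_sub_fderiv_le_of_bound (f := fun u => H (u + (z - a)) w)
    (g := fun u => H u b) (x := a) (C := C / r * ‖z - a‖ + C / r * ‖w - b‖) (half_pos hr)
    (fun u hu => (((h1 w (h2r' hw)).differentiableAt
      (isOpen_ball.mem_nhds (h2r (hmem u hu)))).comp (f := fun u => u + (z - a)) u
        (differentiableAt_id.add_const _)).differentiableWithinAt)
    ((h1 b (h2r' hb)).mono (hhalf.trans h2r)) fun u hu => by
      have e1 := norm_sub_le_of_bound hr (h1 w (h2r' hw)) (fun y hy => hC y hy w (h2r' hw))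
        (hhalf hu) (hmem u hu)
      have e2 := norm_sub_le_of_bound hr (h2 u (h2r (hhalf hu)))
        (fun y hy => hC u (h2r (hhalf hu)) y hy) hb hw
      rw [add_sub_cancel_left] at e1
      calc ‖H (u + (z - a)) w - H u b‖ = ‖(H (u + (z - a)) w - H u w) + (H u w - H u b)‖ := by
            congr 1; abel
        _ ≤ _ := (norm_add_le _ _).trans (add_le_add e1 e2)
  have e := fderiv_comp_add_right (𝕜 := ℂ) (f := fun u => H u w) (x := a) (z - a)
  rw [e, add_sub_cancel] at key
  exact key

/-- Osgood's lemma: a locally bounded separately holomorphic map is holomorphic. -/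
theorem differentiableAt_of_separately {H : E → E' → F} {a : E} {b : E'} {r C : ℝ} (hr : 0 < r)
    (h1 : ∀ w ∈ ball b (2 * r), DifferentiableOn ℂ (fun z => H z w) (ball a (2 * r)))
    (h2 : ∀ z ∈ ball a (2 * r), DifferentiableOn ℂ (fun w => H z w) (ball b (2 * r)))
    (hC : ∀ z ∈ ball a (2 * r), ∀ w ∈ ball b (2 * r), ‖H z w‖ ≤ C) :
    DifferentiableAt ℂ (fun p : E × E' => H p.1 p.2) (a, b) := by
  have hnhds : ball a (2 * r) ×ˢ ball b (2 * r) ∈ 𝓝 (a, b) :=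
    prod_mem_nhds (ball_mem_nhds _ (by positivity)) (ball_mem_nhds _ (by positivity))
  have c1 := continuousAt_fderiv_left hr h1 h2 hC
  have c2 := continuousAt_fderiv_left (H := fun w z => H z w) hr h2 h1 fun z hz w hw => hC w hw z hz
  have := hasStrictFDerivAt_uncurry_coprod (𝕜 := ℂ) (u := (a, b)) (f := H)
    (f₁ := fun z w => fderiv ℂ (fun z => H z w) z) (f₂ := fun z w => fderiv ℂ (fun w => H z w) w)
    (by
      filter_upwards [hnhds] with p hp
      exact ((h1 p.2 hp.2).differentiableAt (isOpen_ball.mem_nhds hp.1)).hasFDerivAt)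
    (by
      filter_upwards [hnhds] with p hp
      exact ((h2 p.1 hp.1).differentiableAt (isOpen_ball.mem_nhds hp.2)).hasFDerivAt)
    c1
    (ContinuousAt.comp (f := fun p : E × E' => (p.2, p.1)) (x := (a, b)) c2
      (continuous_snd.prodMk continuous_fst).continuousAt)
  exact this.hasFDerivAt.differentiableAt

theorem tendstoUniformlyOn_fderiv_ball {ι : Type*} {l : Filter ι} {G : ι → E → F} {x : E} {r : ℝ}
    (hr : 0 < r) (hG : ∀ᶠ n in l, DifferentiableOn ℂ (G n) (ball x (2 * r)))
    (h : TendstoUniformlyOn G 0 l (ball x (2 * r))) :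
    TendstoUniformlyOn (fun n => fderiv ℂ (G n)) 0 l (ball x r) := by
  have hsub : ∀ u ∈ ball x r, ball u r ⊆ ball x (2 * r) := fun u hu =>
    ball_subset_ball' (by rw [mem_ball] at hu; linarith)
  rw [Metric.tendstoUniformlyOn_iff] at h ⊢
  intro ε hε
  filter_upwards [hG, h (ε * (r / 2)) (by positivity)] with n hn hb y hy
  rw [Pi.zero_apply, dist_zero_left]
  refine (norm_fderiv_le_of_bound hr (hn.mono (hsub y hy)) (C := ε * (r / 2))
    fun z hz => ?_).trans_lt ?_
  · simpa using (hb z (hsub y hy hz)).le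
  · rw [div_lt_iff₀ hr]
    nlinarith [mul_pos hε hr]

theorem fderiv_real_eq_restrictScalars [NormedSpace ℝ E] [IsScalarTower ℝ ℂ E] [NormedSpace ℝ F]
    [IsScalarTower ℝ ℂ F] {f : E → F} {x : E} (hf : DifferentiableAt ℂ f x) :
    fderiv ℝ f x = (fderiv ℂ f x).restrictScalars ℝ :=
  (hf.hasFDerivAt.restrictScalars ℝ).fderiv

/-- If holomorphic maps tend to zero uniformly on a ball, then so do their real derivatives of
any order, on a smaller ball. -/
theorem tendstoUniformlyOn_iteratedFDeriv_ball [FiniteDimensional ℂ E]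
    [NormedSpace ℝ E] [IsScalarTower ℝ ℂ E] (m : ℕ) {F : Type} [NormedAddCommGroup F]
    [NormedSpace ℂ F] [CompleteSpace F] [NormedSpace ℝ F] [IsScalarTower ℝ ℂ F]
    {ι : Type*} {l : Filter ι} {G : ι → E → F} {x : E} {r : ℝ} (hr : 0 < r)
    (hG : ∀ᶠ n in l, DifferentiableOn ℂ (G n) (ball x r))
    (h : TendstoUniformlyOn G 0 l (ball x r)) :
    ∃ s > 0, TendstoUniformlyOn (fun n => iteratedFDeriv ℝ m (G n)) 0 l (ball x s) := by
  induction m generalizing F r with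
  | zero =>
    refine ⟨r, hr, ?_⟩
    rw [Metric.tendstoUniformlyOn_iff] at h ⊢
    simpa using h
  | succ m ih =>
    obtain ⟨ρ, hρ, rfl⟩ : ∃ ρ, 0 < ρ ∧ r = 2 * ρ := ⟨r / 2, by positivity, by ring⟩
    have hsub : ball x ρ ⊆ ball x (2 * ρ) := ball_subset_ball (by linarith)
    -- The real derivative is the complex one followed by a complex-linear map, hence again
    -- holomorphic, now with values in `E →L[ℝ] F`; the induction therefore generalizes over `F`.
    have heq : ∀ n, DifferentiableOn ℂ (G n) (ball x (2 * ρ)) → ∀ y ∈ ball x (2 * ρ),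
        fderiv ℝ (G n) y = ContinuousLinearMap.restrictScalarsL ℂ E F ℝ ℂ (fderiv ℂ (G n) y) :=
      fun n hn y hy =>
        fderiv_real_eq_restrictScalars (hn.differentiableAt (isOpen_ball.mem_nhds hy))
    have hd1 : ∀ᶠ n in l, DifferentiableOn ℂ (fderiv ℝ (G n)) (ball x ρ) := by
      filter_upwards [hG] with n hn
      have hd : DifferentiableOn ℂ (fderiv ℂ (G n)) (ball x (2 * ρ)) :=
        ((contDiffOn_of_differentiableOn_complex isOpen_ball hn).fderiv_of_isOpen (m := 1)
          isOpen_ball (by decide)).differentiableOn one_ne_zero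
      refine ((ContinuousLinearMap.restrictScalarsL ℂ E F ℝ ℂ).differentiable.comp_differentiableOn
        (hd.mono hsub)).congr fun y hy => heq n hn y (hsub hy)
    have hd2 : TendstoUniformlyOn (fun n => fderiv ℝ (G n)) 0 l (ball x ρ) := by
      have h1 := tendstoUniformlyOn_fderiv_ball hρ hG h
      rw [Metric.tendstoUniformlyOn_iff] at h1 ⊢
      intro ε hε
      filter_upwards [hG, h1 ε hε] with n hn hb y hy
      have := hb y hy
      rw [Pi.zero_apply, dist_zero_left] at this ⊢
      rw [heq n hn y (hsub hy)]
      simpa using this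
    obtain ⟨s, hs, hlim⟩ := ih (F := E →L[ℝ] F) (G := fun n => fderiv ℝ (G n)) hρ hd1 hd2
    refine ⟨s, hs, ?_⟩
    rw [Metric.tendstoUniformlyOn_iff] at hlim ⊢
    intro ε hε
    filter_upwards [hlim ε hε] with n hn y hy
    have := hn y hy
    rw [Pi.zero_apply, dist_zero_left] at this ⊢
    rwa [norm_iteratedFDeriv_fderiv] at this

/-- Pointwise convergence of uniformly bounded holomorphic maps is uniform on a smaller ball. -/
theorem tendstoUniformlyOn_ball_of_bound [ProperSpace E] {ι : Type*} {l : Filter ι}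
    {G : ι → E → F} {g : E → F} {x : E} {r C : ℝ} (hr : 0 < r)
    (hG : ∀ᶠ n in l, DifferentiableOn ℂ (G n) (ball x (2 * r)))
    (hC : ∀ᶠ n in l, ∀ y ∈ ball x (2 * r), ‖G n y‖ ≤ C)
    (h : ∀ y ∈ ball x r, Tendsto (fun n => G n y) l (𝓝 (g y))) :
    TendstoUniformlyOn G g l (ball x (r / 2)) := by
  rcases l.eq_or_neBot with rfl | hl
  · rw [Metric.tendstoUniformlyOn_iff]; simp
  have hC0 : 0 ≤ C := by
    obtain ⟨n, hn⟩ := hC.exists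
    exact (norm_nonneg _).trans (hn x (mem_ball_self (by positivity)))
  -- The maps share a Lipschitz constant, which the limit inherits; equicontinuity and compactness
  -- of the closed half ball then give uniformity.
  have hGL : ∀ᶠ n in l, ∀ y ∈ ball x r, ∀ z ∈ ball x r, ‖G n z - G n y‖ ≤ C / r * ‖z - y‖ := by
    filter_upwards [hG, hC] with n hn hb y hy z hz using norm_sub_le_of_bound hr hn hb hy hz
  have hgL : ∀ y ∈ ball x r, ∀ z ∈ ball x r, ‖g z - g y‖ ≤ C / r * ‖z - y‖ := fun y hy z hz =>
    le_of_tendsto ((h z hz).sub (h y hy)).norm (hGL.mono fun n hn => hn y hy z hz)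
  refine TendstoUniformlyOn.mono ?_ ball_subset_closedBall
  rw [← tendstoLocallyUniformlyOn_iff_tendstoUniformlyOn_of_compact (isCompact_closedBall x _),
    Metric.tendstoLocallyUniformlyOn_iff]
  intro ε hε y hy
  have hsub : closedBall x (r / 2) ⊆ ball x r := closedBall_subset_ball (by linarith)
  have hδ : 0 < ε / 4 / (C / r + 1) := by positivity
  refine ⟨ball y (ε / 4 / (C / r + 1)) ∩ closedBall x (r / 2),
    Filter.inter_mem (mem_nhdsWithin_of_mem_nhds (ball_mem_nhds _ hδ)) self_mem_nhdsWithin, ?_⟩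
  filter_upwards [hGL, Metric.tendsto_nhds.1 (h y (hsub hy)) (ε / 4) (by positivity)] with
    n hn hny z hz
  have hd : C / r * ‖z - y‖ ≤ ε / 4 := by
    have h1 := hz.1
    rw [mem_ball, dist_eq_norm, lt_div_iff₀ (by positivity)] at h1
    nlinarith [norm_nonneg (z - y)]
  have e1 := hn y (hsub hy) z (hsub hz.2)
  have e2 := hgL y (hsub hy) z (hsub hz.2)
  rw [dist_eq_norm] at hny ⊢
  calc ‖g z - G n z‖ = ‖(g z - g y) - (G n z - G n y) - (G n y - g y)‖ := by congr 1; abel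
    _ ≤ ‖g z - g y‖ + ‖G n z - G n y‖ + ‖G n y - g y‖ :=
      (norm_sub_le _ _).trans (add_le_add_left (norm_sub_le _ _) _)
    _ < ε := by linarith

end SeveralComplexVariables

/-! ### Mean value property and bounds for point evaluations -/

section BergmanInequality

open Metric

variable {n : ℕ}

theorem measurePreserving_smul_of_norm_eq_one {c : ℂ} (hc : ‖c‖ = 1) :
    MeasurePreserving (fun h : Fin n → ℂ => c • h) := by
  obtain ⟨a, rfl⟩ : ∃ a : Circle, (a : ℂ) = c := ⟨⟨c, mem_sphere_zero_iff_norm.2 hc⟩, rfl⟩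
  have h1 : MeasurePreserving (fun z : ℂ => (a : ℂ) * z) := (rotation a).measurePreserving
  exact volume_preserving_pi fun _ : Fin n => h1

/-- The mean value property over balls in `ℂⁿ`. -/
theorem setIntegral_closedBall_eq {f : (Fin n → ℂ) → ℂ} {U : Set (Fin n → ℂ)} (hU : IsOpen U)
    (hf : DifferentiableOn ℂ f U) {z : Fin n → ℂ} {r : ℝ} (hzr : closedBall z r ⊆ U) :
    ∫ h in closedBall (0 : Fin n → ℂ) r, f (z + h) =
      (volume (closedBall (0 : Fin n → ℂ) r)).toReal • f z := by
  have hmem : ∀ t : ℂ, ‖t‖ ≤ 1 → ∀ h ∈ closedBall (0 : Fin n → ℂ) r, z + t • h ∈ U := by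
    intro t ht h hh
    refine hzr ?_
    rw [mem_closedBall_zero_iff] at hh
    rw [mem_closedBall, dist_eq_norm, add_sub_cancel_left, norm_smul]
    nlinarith [norm_nonneg h, norm_nonneg t]
  -- The ball and Lebesgue measure are invariant under `h ↦ e^{iθ} h`, so averaging over `θ` and
  -- applying Fubini reduces to the one-variable mean value property on the discs `t ↦ z + t h`.
  have hmv : ∀ h ∈ closedBall (0 : Fin n → ℂ) r,
      Real.circleAverage (fun t : ℂ => f (z + t • h)) 0 1 = f z := by
    intro h hh
    have hd : DiffContOnCl ℂ (fun t : ℂ => f (z + t • h)) (ball 0 |(1 : ℝ)|) := by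
      refine DifferentiableOn.diffContOnCl fun t ht => ?_
      have ht1 : ‖t‖ ≤ 1 := by
        have := closure_ball_subset_closedBall ht
        simpa using this
      exact ((hf.differentiableAt (hU.mem_nhds (hmem t ht1 h hh))).comp t
        ((differentiableAt_id.smul_const h).const_add z)).differentiableWithinAt
    have := hd.circleAverage
    simpa using this
  have hnorm : ∀ θ : ℝ, ‖circleMap 0 1 θ‖ = 1 := fun θ => by simp
  have hrot : ∀ θ : ℝ, ∫ h in closedBall (0 : Fin n → ℂ) r, f (z + circleMap 0 1 θ • h) =
      ∫ h in closedBall (0 : Fin n → ℂ) r, f (z + h) := by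
    intro θ
    have hc := hnorm θ
    set c := circleMap 0 1 θ
    have hc0 : c ≠ 0 := norm_ne_zero_iff.1 (by rw [hc]; exact one_ne_zero)
    have hmp := measurePreserving_smul_of_norm_eq_one (n := n) hc
    have hemb : MeasurableEmbedding (fun h : Fin n → ℂ => c • h) :=
      (Homeomorph.smulOfNeZero c hc0).measurableEmbedding
    have := hmp.setIntegral_preimage_emb hemb (fun h => f (z + h)) (closedBall 0 r)
    rw [← this]
    congr 2
    ext h
    simp [norm_smul, hc]
  have hint : IntegrableOn (fun p : ℝ × (Fin n → ℂ) => f (z + circleMap 0 1 p.1 • p.2))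
      (Set.Icc 0 (2 * Real.pi) ×ˢ closedBall 0 r) (volume.prod volume) := by
    refine ContinuousOn.integrableOn_compact
      (isCompact_Icc.prod (isCompact_closedBall _ _)) ?_
    refine hf.continuousOn.comp (t := U) (by fun_prop) fun p hp => hmem _ (hnorm _).le _ hp.2
  have hswap : ∫ θ in (0 : ℝ)..2 * Real.pi,
      ∫ h in closedBall (0 : Fin n → ℂ) r, f (z + circleMap 0 1 θ • h) =
      ∫ h in closedBall (0 : Fin n → ℂ) r,
        ∫ θ in (0 : ℝ)..2 * Real.pi, f (z + circleMap 0 1 θ • h) := by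
    simp_rw [intervalIntegral.integral_of_le Real.two_pi_pos.le]
    refine integral_integral_swap ?_
    rw [Measure.prod_restrict]
    exact hint.mono_set (Set.prod_mono Set.Ioc_subset_Icc_self subset_rfl)
  have hpi : (2 * Real.pi) ≠ 0 := Real.two_pi_pos.ne'
  have h1 : ∫ h in closedBall (0 : Fin n → ℂ) r,
      ∫ θ in (0 : ℝ)..2 * Real.pi, f (z + circleMap 0 1 θ • h) =
      ∫ h in closedBall (0 : Fin n → ℂ) r, (2 * Real.pi) • f z := by
    refine setIntegral_congr_fun isClosed_closedBall.measurableSet fun h hh => ?_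
    have := hmv h hh
    rw [Real.circleAverage_def] at this
    rw [← this, smul_inv_smul₀ hpi]
  rw [h1] at hswap
  simp_rw [hrot] at hswap
  rw [intervalIntegral.integral_const, sub_zero, setIntegral_const, smul_comm] at hswap
  exact smul_right_injective ℂ hpi hswap

/-- The Bergman inequality. -/
theorem norm_sq_mul_volume_le {f : (Fin n → ℂ) → ℂ} {U : Set (Fin n → ℂ)} (hU : IsOpen U)
    (hf : DifferentiableOn ℂ f U) {z : Fin n → ℂ} {r : ℝ} (hzr : closedBall z r ⊆ U) :
    ‖f z‖ ^ 2 * (volume (closedBall (0 : Fin n → ℂ) r)).toReal ≤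
      ∫ w in closedBall z r, ‖f w‖ ^ 2 := by
  -- Using `f ^ 2`, which is holomorphic with modulus the desired integrand, avoids Cauchy-Schwarz.
  have h := setIntegral_closedBall_eq hU (hf.pow 2) hzr
  have hshift : ∫ h in closedBall (0 : Fin n → ℂ) r, ‖f (z + h)‖ ^ 2 =
      ∫ w in closedBall z r, ‖f w‖ ^ 2 := by
    have := (measurePreserving_add_left volume z).setIntegral_preimage_emb
      (Homeomorph.addLeft z).measurableEmbedding (fun w => ‖f w‖ ^ 2) (closedBall z r)
    rw [← this]
    congr 2
    ext h
    simp [dist_eq_norm]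
  rw [← hshift]
  have h2 := norm_integral_le_integral_norm (μ := volume.restrict (closedBall (0 : Fin n → ℂ) r))
    (fun h => f (z + h) ^ 2)
  simp only [Pi.pow_apply] at h
  rw [h, norm_smul, norm_pow, Real.norm_of_nonneg ENNReal.toReal_nonneg, mul_comm] at h2
  simpa using h2

/-- Point evaluations are bounded on weighted Bergman spaces, locally uniformly. -/
theorem exists_norm_sq_le {D : Set (Fin n → ℂ)} (hD : IsOpen D) {φ : (Fin n → ℂ) → ℝ}
    (hφ : ContinuousOn φ D) (hpos : ∀ z ∈ D, 0 < φ z) {z₀ : Fin n → ℂ} (hz₀ : z₀ ∈ D) :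
    ∃ r > 0, ∃ C, 0 ≤ C ∧ ball z₀ r ⊆ D ∧ ∀ f, MemWeightedBergman D φ f → ∀ z ∈ ball z₀ r,
      ‖f z‖ ^ 2 ≤ C * ∫ w in D, ‖f w‖ ^ 2 * φ w := by
  have hev : ∀ᶠ w in 𝓝 z₀, w ∈ D ∧ φ z₀ / 2 < φ w := by
    have hc := hφ.continuousAt (hD.mem_nhds hz₀)
    filter_upwards [hD.mem_nhds hz₀, hc.eventually_const_lt (half_lt_self (hpos _ hz₀))] with w h1 h2
      using ⟨h1, h2⟩
  obtain ⟨R, hR, hRD⟩ := Metric.eventually_nhds_iff_ball.1 hev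
  have hRD' : ball z₀ R ⊆ D := fun w hw => (hRD w hw).1
  set c := φ z₀ / 2
  have hc : 0 < c := half_pos (hpos _ hz₀)
  set v := (volume (closedBall (0 : Fin n → ℂ) (R / 4))).toReal
  have hv : 0 < v := ENNReal.toReal_pos (measure_closedBall_pos _ _ (by positivity)).ne'
    measure_closedBall_lt_top.ne
  -- Here `c` bounds the weight below on the ball of radius `R`, and `v` is the volume of the balls
  -- of radius `R / 4` about nearby points, which stay inside it.
  refine ⟨R / 4, by positivity, (v * c)⁻¹, by positivity,
    (ball_subset_ball (by linarith)).trans hRD', fun f hf z hz => ?_⟩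
  have hsub : closedBall z (R / 4) ⊆ ball z₀ R := closedBall_subset_ball' (by
    rw [mem_ball] at hz; linarith)
  have h1 := norm_sq_mul_volume_le hD hf.1 (hsub.trans hRD')
  have hfc : ContinuousOn (fun w => ‖f w‖ ^ 2) (closedBall z (R / 4)) :=
    ((hf.1.continuousOn).mono (hsub.trans hRD')).norm.pow 2
  have h2 : (∫ w in closedBall z (R / 4), ‖f w‖ ^ 2) * c ≤ ∫ w in D, ‖f w‖ ^ 2 * φ w := by
    rw [← integral_mul_const]
    refine (setIntegral_mono_on ((hfc.integrableOn_compact (isCompact_closedBall _ _)).mul_const _)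
      (hf.2.mono_set (hsub.trans hRD')) isClosed_closedBall.measurableSet fun w hw => ?_).trans ?_
    · exact mul_le_mul_of_nonneg_left (hRD w (hsub hw)).2.le (by positivity)
    · refine setIntegral_mono_set hf.2 ?_ (hsub.trans hRD').eventuallyLE
      filter_upwards [ae_restrict_mem hD.measurableSet] with w hw
      exact mul_nonneg (by positivity) (hpos w hw).le
  rw [inv_mul_eq_div, le_div_iff₀ (by positivity), ← mul_assoc]
  exact (mul_le_mul_of_nonneg_right h1 hc.le).trans h2

end BergmanInequality

/-! ### Weighted Bergman spaces as Hilbert spaces and existence of kernels -/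

section WeightedBergmanSpace

variable {n : ℕ} {D : Set (Fin n → ℂ)} {φ : (Fin n → ℂ) → ℝ} {f g : (Fin n → ℂ) → ℂ}

/-- A continuous positive weight on `D`. -/
structure IsContinuousWeight {n : ℕ} (D : Set (Fin n → ℂ)) (φ : (Fin n → ℂ) → ℝ) : Prop where
  continuousOn : ContinuousOn φ D
  pos : ∀ z ∈ D, 0 < φ z

theorem aestronglyMeasurable_mul_sqrt (hD : IsOpen D) (hφ : IsContinuousWeight D φ)
    (hf : ContinuousOn f D) :
    AEStronglyMeasurable (fun z => f z * (√(φ z) : ℝ)) (volume.restrict D) := by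
  refine ContinuousOn.aestronglyMeasurable ?_ hD.measurableSet
  exact hf.mul (Complex.continuous_ofReal.comp_continuousOn hφ.continuousOn.sqrt)

theorem norm_sq_mul_sqrt (hφ : IsContinuousWeight D φ) {z : Fin n → ℂ} (hz : z ∈ D) (a : ℂ) :
    ‖a * (√(φ z) : ℝ)‖ ^ 2 = ‖a‖ ^ 2 * φ z := by
  rw [norm_mul, mul_pow, Complex.norm_real, Real.norm_of_nonneg (Real.sqrt_nonneg _),
    Real.sq_sqrt (hφ.pos z hz).le]

theorem memWeightedBergman_iff (hD : IsOpen D) (hφ : IsContinuousWeight D φ)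
    (hf : DifferentiableOn ℂ f D) : MemWeightedBergman D φ f ↔
      MemLp (fun z => f z * (√(φ z) : ℝ)) 2 (volume.restrict D) := by
  rw [memLp_two_iff_integrable_sq_norm (aestronglyMeasurable_mul_sqrt hD hφ hf.continuousOn),
    MemWeightedBergman, and_iff_right hf]
  refine integrable_congr ?_
  filter_upwards [ae_restrict_mem hD.measurableSet] with z hz
  rw [norm_sq_mul_sqrt hφ hz]

theorem MemWeightedBergman.memLp (hD : IsOpen D) (hφ : IsContinuousWeight D φ)
    (hf : MemWeightedBergman D φ f) :
    MemLp (fun z => f z * (√(φ z) : ℝ)) 2 (volume.restrict D) :=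
  (memWeightedBergman_iff hD hφ hf.1).1 hf

theorem MemWeightedBergman.add (hD : IsOpen D) (hφ : IsContinuousWeight D φ)
    (hf : MemWeightedBergman D φ f) (hg : MemWeightedBergman D φ g) :
    MemWeightedBergman D φ (fun z => f z + g z) := by
  refine (memWeightedBergman_iff hD hφ (hf.1.add hg.1)).2 ?_
  convert (hf.memLp hD hφ).add (hg.memLp hD hφ) using 2 with z
  exact add_mul _ _ _

theorem MemWeightedBergman.const_mul (hD : IsOpen D) (hφ : IsContinuousWeight D φ)
    (hf : MemWeightedBergman D φ f) (c : ℂ) : MemWeightedBergman D φ (fun z => c * f z) := by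
  refine (memWeightedBergman_iff hD hφ (hf.1.const_mul c)).2 ?_
  convert (hf.memLp hD hφ).const_smul c using 2 with z
  exact mul_assoc _ _ _

theorem MemWeightedBergman.sub (hD : IsOpen D) (hφ : IsContinuousWeight D φ)
    (hf : MemWeightedBergman D φ f) (hg : MemWeightedBergman D φ g) :
    MemWeightedBergman D φ (fun z => f z - g z) := by
  have := hf.add hD hφ (hg.const_mul hD hφ (-1))
  simpa [sub_eq_add_neg] using this

theorem MemWeightedBergman.integrable_conj_mul (hD : IsOpen D) (hφ : IsContinuousWeight D φ)
    (hf : MemWeightedBergman D φ f) (hg : MemWeightedBergman D φ g) :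
    IntegrableOn (fun z => conj (f z) * g z * (φ z : ℂ)) D := by
  have := (hf.memLp hD hφ).star.integrable_mul (hg.memLp hD hφ)
  refine this.congr ?_
  filter_upwards [ae_restrict_mem hD.measurableSet] with z hz
  have h : ((√(φ z) : ℝ) : ℂ) * (√(φ z) : ℝ) = (φ z : ℂ) := by
    rw [← Complex.ofReal_mul, Real.mul_self_sqrt (hφ.pos z hz).le]
  simp only [Pi.mul_apply, Pi.star_apply, star_mul', RCLike.star_def, Complex.conj_ofReal]
  rw [← h]
  ring

theorem norm_sq_toLp (hD : IsOpen D) (hφ : IsContinuousWeight D φ)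
    {u : Lp ℂ 2 (volume.restrict D)}
    (hu : u =ᵐ[volume.restrict D] fun z => f z * (√(φ z) : ℝ)) :
    ‖u‖ ^ 2 = ∫ z in D, ‖f z‖ ^ 2 * φ z := by
  rw [@norm_sq_eq_re_inner ℂ, L2.inner_def, ← integral_re (L2.integrable_inner u u)]
  refine integral_congr_ae ?_
  filter_upwards [hu, ae_restrict_mem hD.measurableSet] with z hz hzD
  rw [← norm_sq_eq_re_inner, hz, norm_sq_mul_sqrt hφ hzD]

theorem inner_toLp (hD : IsOpen D) (hφ : IsContinuousWeight D φ)
    {u v : Lp ℂ 2 (volume.restrict D)}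
    (hu : u =ᵐ[volume.restrict D] fun z => f z * (√(φ z) : ℝ))
    (hv : v =ᵐ[volume.restrict D] fun z => g z * (√(φ z) : ℝ)) :
    inner ℂ u v = ∫ z in D, conj (f z) * g z * (φ z : ℂ) := by
  rw [L2.inner_def]
  refine integral_congr_ae ?_
  filter_upwards [hu, hv, ae_restrict_mem hD.measurableSet] with z hz hz' hzD
  have h : ((√(φ z) : ℝ) : ℂ) * (√(φ z) : ℝ) = (φ z : ℂ) := by
    rw [← Complex.ofReal_mul, Real.mul_self_sqrt (hφ.pos z hzD).le]
  rw [hz, hz', RCLike.inner_apply, map_mul, ← h, Complex.conj_ofReal]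
  ring

/-- The weighted Bergman space, embedded in `L²(D)` by `f ↦ f √φ`. -/
def bergmanSubmodule (hD : IsOpen D) (hφ : IsContinuousWeight D φ) :
    Submodule ℂ (Lp ℂ 2 (volume.restrict D)) where
  carrier := {u | ∃ f, MemWeightedBergman D φ f ∧
    u =ᵐ[volume.restrict D] fun z => f z * (√(φ z) : ℝ)}
  zero_mem' := by
    refine ⟨fun _ => 0, ⟨differentiableOn_const 0, by simp⟩, ?_⟩
    filter_upwards [Lp.coeFn_zero ℂ 2 (volume.restrict D)] with z hz
    rw [hz]; simp
  add_mem' := by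
    rintro u v ⟨f, hf, hu⟩ ⟨g, hg, hv⟩
    refine ⟨_, hf.add hD hφ hg, ?_⟩
    filter_upwards [Lp.coeFn_add u v, hu, hv] with z hz hzu hzv
    rw [hz, Pi.add_apply, hzu, hzv]; ring
  smul_mem' := by
    rintro c u ⟨f, hf, hu⟩
    refine ⟨_, hf.const_mul hD hφ c, ?_⟩
    filter_upwards [Lp.coeFn_smul c u, hu] with z hz hzu
    rw [hz, Pi.smul_apply, hzu, smul_eq_mul]; ring

/-- Continuous functions equal almost everywhere on an open set are equal there. This makes
evaluation well defined and linear on classes in `L²`. -/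
theorem eqOn_of_ae_eq (hD : IsOpen D) (hφ : IsContinuousWeight D φ)
    (hf : MemWeightedBergman D φ f) (hg : MemWeightedBergman D φ g)
    (h : (fun z => f z * (√(φ z) : ℝ)) =ᵐ[volume.restrict D] fun z => g z * (√(φ z) : ℝ)) :
    Set.EqOn f g D := by
  refine Measure.eqOn_open_of_ae_eq (μ := volume) ?_ hD hf.1.continuousOn hg.1.continuousOn
  filter_upwards [h, ae_restrict_mem hD.measurableSet] with z hz hzD
  refine mul_right_cancel₀ ?_ hz
  exact_mod_cast (Real.sqrt_pos.2 (hφ.pos z hzD)).ne'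

/-- Bounded point evaluations turn `L²` convergence into locally uniform convergence, so there is a
holomorphic limit; an almost everywhere convergent subsequence identifies it with the `L²` limit. -/
theorem isClosed_bergmanSubmodule (hD : IsOpen D) (hφ : IsContinuousWeight D φ) :
    IsClosed (bergmanSubmodule hD hφ : Set (Lp ℂ 2 (volume.restrict D))) := by
  refine IsSeqClosed.isClosed fun u u₀ hu hlim => ?_
  choose f hf hfu using hu
  have hsub : ∀ k l, ∫ z in D, ‖f k z - f l z‖ ^ 2 * φ z = ‖u k - u l‖ ^ 2 := fun k l => by
    refine (norm_sq_toLp hD hφ (u := u k - u l) ?_).symm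
    filter_upwards [Lp.coeFn_sub (u k) (u l), hfu k, hfu l] with z hz hk hl
    rw [hz, Pi.sub_apply, hk, hl]; ring
  have hunif : ∀ z ∈ D, ∃ r > 0, Metric.ball z r ⊆ D ∧
      UniformCauchySeqOn f atTop (Metric.ball z r) := by
    intro z hz
    obtain ⟨r, hr, C, hC, hrD, hb⟩ := exists_norm_sq_le hD hφ.continuousOn hφ.pos hz
    refine ⟨r, hr, hrD, Metric.uniformCauchySeqOn_iff.2 fun ε hε => ?_⟩
    obtain ⟨N, hN⟩ := Metric.cauchySeq_iff.1 hlim.cauchySeq (ε / (√C + 1)) (by positivity)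
    refine ⟨N, fun k hk l hl x hx => ?_⟩
    have h1 := hb _ ((hf k).sub hD hφ (hf l)) x hx
    rw [hsub] at h1
    have h2 := hN k hk l hl
    rw [dist_eq_norm, lt_div_iff₀ (by positivity)] at h2
    rw [dist_eq_norm]
    have h3 : ‖f k x - f l x‖ ≤ √C * ‖u k - u l‖ := by
      refine le_of_sq_le_sq ?_ (by positivity)
      rwa [mul_pow, Real.sq_sqrt hC]
    nlinarith [norm_nonneg (u k - u l)]
  have hpt : ∀ z ∈ D, ∃ a, Tendsto (fun k => f k z) atTop (𝓝 a) := fun z hz => by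
    obtain ⟨r, hr, -, h⟩ := hunif z hz
    exact cauchySeq_tendsto_of_complete (h.cauchySeq (Metric.mem_ball_self hr))
  choose! F hF using hpt
  have hFd : DifferentiableOn ℂ F D := fun z hz => by
    obtain ⟨r, hr, hrD, h⟩ := hunif z hz
    exact (differentiableAt_of_tendstoUniformlyOn_ball hr
      (Eventually.of_forall fun k => (hf k).1.mono hrD)
      (h.tendstoUniformlyOn_of_tendsto fun x hx => hF x (hrD hx))).differentiableWithinAt
  obtain ⟨ns, hns, hae⟩ := (tendstoInMeasure_of_tendsto_Lp hlim).exists_seq_tendsto_ae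
  have hFu : u₀ =ᵐ[volume.restrict D] fun z => F z * (√(φ z) : ℝ) := by
    filter_upwards [hae, ae_all_iff.2 hfu, ae_restrict_mem hD.measurableSet] with z hz hfz hzD
    refine tendsto_nhds_unique hz ?_
    simp_rw [hfz]
    exact ((hF z hzD).comp hns.tendsto_atTop).mul_const _
  exact ⟨F, (memWeightedBergman_iff hD hφ hFd).2 ((memLp_congr_ae hFu).1 (Lp.memLp u₀)), hFu⟩

/-- Weighted Bergman spaces have reproducing kernels. -/
theorem exists_isReproducingKernel (hD : IsOpen D) (hφ : IsContinuousWeight D φ) :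
    ∃ K, IsReproducingKernel D φ K := by
  have : CompleteSpace (bergmanSubmodule hD hφ) :=
    (isClosed_bergmanSubmodule hD hφ).completeSpace_coe
  choose rep hrep hrepu using fun u : bergmanSubmodule hD hφ => u.2
  -- Riesz representation of evaluation at `z`; the kernel will be `K(z, w) = k_w(z)`.
  have hev : ∀ z ∈ D, ∃ k : bergmanSubmodule hD hφ, ∀ u, inner ℂ k u = rep u z := by
    intro z hz
    obtain ⟨r, hr, C, hC, -, hb⟩ := exists_norm_sq_le hD hφ.continuousOn hφ.pos hz
    let ev : bergmanSubmodule hD hφ →ₗ[ℂ] ℂ :=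
      { toFun := fun u => rep u z
        map_add' := fun u v => by
          refine eqOn_of_ae_eq hD hφ (hrep (u + v)) ((hrep u).add hD hφ (hrep v)) ?_ hz
          filter_upwards [hrepu (u + v), hrepu u, hrepu v, Lp.coeFn_add u.1 v.1] with x h1 h2 h3 h4
          rw [← h1, add_mul, ← h2, ← h3]
          exact h4
        map_smul' := fun c u => by
          refine eqOn_of_ae_eq hD hφ (hrep (c • u)) ((hrep u).const_mul hD hφ c) ?_ hz
          filter_upwards [hrepu (c • u), hrepu u, Lp.coeFn_smul c u.1] with x h1 h2 h3
          rw [← h1, mul_assoc, ← h2]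
          exact h3 }
    let evc := ev.mkContinuous (√C) fun u => by
      have h1 := hb _ (hrep u) z (Metric.mem_ball_self hr)
      rw [← norm_sq_toLp hD hφ (hrepu u)] at h1
      refine le_of_sq_le_sq ?_ (by positivity)
      rwa [mul_pow, Real.sq_sqrt hC]
    exact ⟨(InnerProductSpace.toDual ℂ _).symm evc, fun u => by
      rw [InnerProductSpace.toDual_symm_apply]; rfl⟩
  choose! k hk using hev
  have hinner : ∀ z ∈ D, ∀ f, MemWeightedBergman D φ f →
      f z = ∫ w in D, conj (rep (k z) w) * f w * (φ w : ℂ) := by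
    intro z hz f hf
    let u : bergmanSubmodule hD hφ := ⟨(hf.memLp hD hφ).toLp _, f, hf, MemLp.coeFn_toLp _⟩
    have h1 : rep u z = f z := by
      refine eqOn_of_ae_eq hD hφ (hrep u) hf ?_ hz
      exact (hrepu u).symm.trans (MemLp.coeFn_toLp (hf.memLp hD hφ))
    rw [← h1, ← hk z hz u]
    exact inner_toLp hD hφ (hrepu (k z)) (MemLp.coeFn_toLp (hf.memLp hD hφ))
  have hsymm : ∀ z ∈ D, ∀ w ∈ D, rep (k w) z = conj (rep (k z) w) := by
    intro z hz w hw
    rw [← hk z hz, ← hk w hw]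
    exact (inner_conj_symm (𝕜 := ℂ) (k z) (k w)).symm
  refine ⟨fun z w => rep (k w) z, fun w _ => hrep (k w), hsymm, fun f hf z hz => ?_⟩
  rw [hinner z hz f hf]
  refine setIntegral_congr_fun hD.measurableSet fun w hw => ?_
  rw [hsymm z hz w hw]

theorem isReproducingKernel_weightedBergmanKernel (hD : IsOpen D) (hφ : IsContinuousWeight D φ) :
    IsReproducingKernel D φ (weightedBergmanKernel D φ) := by
  have h := exists_isReproducingKernel hD hφ
  rw [weightedBergmanKernel, dif_pos h]
  exact h.choose_spec

end WeightedBergmanSpace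

/-! ### Extremal properties, monotonicity and smoothness of kernels -/

section ReproducingKernel

open Metric

variable {n : ℕ} {D D' : Set (Fin n → ℂ)} {φ φ' : (Fin n → ℂ) → ℝ} {f : (Fin n → ℂ) → ℂ}
  {K K' : (Fin n → ℂ) → (Fin n → ℂ) → ℂ}

theorem IsReproducingKernel.integral_conj_mul (hD : IsOpen D) (hK : IsReproducingKernel D φ K)
    (hf : MemWeightedBergman D φ f) {w : Fin n → ℂ} (hw : w ∈ D) :
    ∫ z in D, conj (K z w) * f z * (φ z : ℂ) = f w := by
  rw [hK.reproduces f hf w hw]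
  refine setIntegral_congr_fun hD.measurableSet fun z hz => ?_
  rw [hK.symm w hw z hz]

theorem IsReproducingKernel.self_eq (hK : IsReproducingKernel D φ K) {w : Fin n → ℂ}
    (hw : w ∈ D) : K w w = ((K w w).re : ℂ) :=
  (Complex.conj_eq_iff_re.1 (hK.symm w hw w hw).symm).symm

theorem IsReproducingKernel.self_re (hD : IsOpen D) (hK : IsReproducingKernel D φ K)
    {w : Fin n → ℂ} (hw : w ∈ D) : (K w w).re = ∫ z in D, ‖K z w‖ ^ 2 * φ z := by
  have h := hK.integral_conj_mul hD (hK.mem w hw) hw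
  have h2 : ∫ z in D, conj (K z w) * K z w * (φ z : ℂ) =
      ((∫ z in D, ‖K z w‖ ^ 2 * φ z : ℝ) : ℂ) := by
    rw [← integral_complex_ofReal]
    refine integral_congr_ae (Eventually.of_forall fun z => ?_)
    simp only
    rw [Complex.conj_mul']
    push_cast; ring
  rw [← h, h2, Complex.ofReal_re]

theorem IsReproducingKernel.self_re_nonneg (hD : IsOpen D) (hφ : IsContinuousWeight D φ)
    (hK : IsReproducingKernel D φ K) {w : Fin n → ℂ} (hw : w ∈ D) : 0 ≤ (K w w).re := by
  rw [hK.self_re hD hw]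
  exact setIntegral_nonneg hD.measurableSet fun z hz =>
    mul_nonneg (by positivity) (hφ.pos z hz).le

/-- Expansion of the square, with the cross term evaluated by the reproducing property. All the
extremal inequalities come from this identity by choosing `f` and `c`. -/
theorem IsReproducingKernel.integral_norm_sq_sub (hD : IsOpen D) (hφ : IsContinuousWeight D φ)
    (hK : IsReproducingKernel D φ K) (hf : MemWeightedBergman D φ f) {w : Fin n → ℂ} (hw : w ∈ D)
    (c : ℂ) : ∫ z in D, ‖f z - c * K z w‖ ^ 2 * φ z =
      (∫ z in D, ‖f z‖ ^ 2 * φ z) - 2 * (conj c * f w).re + ‖c‖ ^ 2 * (K w w).re := by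
  have hcross := (hK.mem w hw).integrable_conj_mul hD hφ hf
  have hre : ∫ z in D, (conj c * (conj (K z w) * f z * (φ z : ℂ))).re = (conj c * f w).re := by
    have h1 := integral_re (hcross.const_mul (conj c))
    simp only [RCLike.re_to_complex] at h1
    rw [h1, integral_const_mul, hK.integral_conj_mul hD hf hw]
  have hint : IntegrableOn (fun z => 2 * (conj c * (conj (K z w) * f z * (φ z : ℂ))).re) D :=
    (hcross.const_mul (conj c)).re.const_mul 2
  have hsub : IntegrableOn (fun z => ‖f z‖ ^ 2 * φ z -
      2 * (conj c * (conj (K z w) * f z * (φ z : ℂ))).re) D := hf.2.sub hint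
  have hKint : IntegrableOn (fun z => ‖c‖ ^ 2 * (‖K z w‖ ^ 2 * φ z)) D :=
    (hK.mem w hw).2.const_mul _
  rw [hK.self_re hD hw, ← hre, ← integral_const_mul, ← integral_const_mul,
    ← integral_sub hf.2 hint, ← integral_add hsub hKint]
  refine integral_congr_ae (Eventually.of_forall fun z => ?_)
  simp only [← Complex.normSq_eq_norm_sq, Complex.normSq_apply, Complex.sub_re, Complex.sub_im,
    Complex.mul_re, Complex.mul_im, Complex.conj_re, Complex.conj_im, Complex.ofReal_re,
    Complex.ofReal_im]
  ring

theorem integral_norm_sq_nonneg (hD : IsOpen D) (hφ : IsContinuousWeight D φ) :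
    0 ≤ ∫ z in D, ‖f z‖ ^ 2 * φ z :=
  setIntegral_nonneg hD.measurableSet fun z hz => mul_nonneg (by positivity) (hφ.pos z hz).le

/-- The kernel bounds point evaluations. -/
theorem IsReproducingKernel.norm_sq_le (hD : IsOpen D) (hφ : IsContinuousWeight D φ)
    (hK : IsReproducingKernel D φ K) (hf : MemWeightedBergman D φ f) {w : Fin n → ℂ} (hw : w ∈ D) :
    ‖f w‖ ^ 2 ≤ (K w w).re * ∫ z in D, ‖f z‖ ^ 2 * φ z := by
  set N := ∫ z in D, ‖f z‖ ^ 2 * φ z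
  -- This is `‖f - s f(w) K(·, w)‖² ≥ 0` as a quadratic in real `s`. Its discriminant gives the
  -- bound without dividing by `K(w, w)`, which may vanish.
  have key : ∀ s : ℝ, 0 ≤ ‖f w‖ ^ 2 * (K w w).re * (s * s) + (-(2 * ‖f w‖ ^ 2)) * s + N := by
    intro s
    have h := hK.integral_norm_sq_sub hD hφ hf hw ((s : ℂ) * f w)
    have h0 : (conj ((s : ℂ) * f w) * f w).re = s * ‖f w‖ ^ 2 := by
      rw [map_mul, Complex.conj_ofReal, mul_assoc, Complex.conj_mul', ← Complex.ofReal_pow,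
        ← Complex.ofReal_mul, Complex.ofReal_re]
    have h1 := integral_norm_sq_nonneg (f := fun z => f z - (s : ℂ) * f w * K z w) hD hφ
    rw [h, h0, norm_mul, mul_pow, Complex.norm_real, Real.norm_eq_abs, sq_abs] at h1
    linarith
  have hdisc := discrim_le_zero key
  rw [discrim] at hdisc
  rcases (sq_nonneg ‖f w‖).eq_or_lt with h0 | h0
  · rw [← h0]
    exact mul_nonneg (hK.self_re_nonneg hD hφ hw) (integral_norm_sq_nonneg hD hφ)
  · refine le_of_mul_le_mul_left ?_ h0
    linarith

theorem IsReproducingKernel.norm_sq_kernel_le (hD : IsOpen D) (hφ : IsContinuousWeight D φ)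
    (hK : IsReproducingKernel D φ K) {z w : Fin n → ℂ} (hz : z ∈ D) (hw : w ∈ D) :
    ‖K z w‖ ^ 2 ≤ (K z z).re * (K w w).re := by
  rw [hK.self_re hD hw]
  exact hK.norm_sq_le hD hφ (hK.mem w hw) hz

theorem MemWeightedBergman.mono (hD' : IsOpen D') (hφ' : IsContinuousWeight D' φ')
    (hsub : D' ⊆ D) (hle : ∀ z ∈ D', φ' z ≤ φ z) (hf : MemWeightedBergman D φ f) :
    MemWeightedBergman D' φ' f := by
  refine ⟨hf.1.mono hsub, (hf.2.mono_set hsub).mono' ?_ ?_⟩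
  · exact (((hf.1.continuousOn.mono hsub).norm.pow 2).mul
      hφ'.continuousOn).aestronglyMeasurable hD'.measurableSet
  · filter_upwards [ae_restrict_mem hD'.measurableSet] with z hz
    rw [Real.norm_of_nonneg (mul_nonneg (by positivity) (hφ'.pos z hz).le)]
    exact mul_le_mul_of_nonneg_left (hle z hz) (by positivity)

theorem MemWeightedBergman.integral_mono (hD : IsOpen D) (hφ : IsContinuousWeight D φ)
    (hD' : IsOpen D') (hφ' : IsContinuousWeight D' φ')
    (hsub : D' ⊆ D) (hle : ∀ z ∈ D', φ' z ≤ φ z) (hf : MemWeightedBergman D φ f) :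
    ∫ z in D', ‖f z‖ ^ 2 * φ' z ≤ ∫ z in D, ‖f z‖ ^ 2 * φ z := by
  refine (setIntegral_mono_on (hf.mono hD' hφ' hsub hle).2 (hf.2.mono_set hsub) hD'.measurableSet
    fun z hz => mul_le_mul_of_nonneg_left (hle z hz) (by positivity)).trans ?_
  refine setIntegral_mono_set hf.2 ?_ hsub.eventuallyLE
  filter_upwards [ae_restrict_mem hD.measurableSet] with w hw
  exact mul_nonneg (by positivity) (hφ.pos w hw).le

/-- Shrinking the domain and the weight increases the kernel, with an estimate in norm. -/
theorem IsReproducingKernel.integral_norm_sq_sub_le (hD : IsOpen D) (hφ : IsContinuousWeight D φ)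
    (hK : IsReproducingKernel D φ K) (hD' : IsOpen D') (hφ' : IsContinuousWeight D' φ')
    (hK' : IsReproducingKernel D' φ' K') (hsub : D' ⊆ D) (hle : ∀ z ∈ D', φ' z ≤ φ z)
    {w : Fin n → ℂ} (hw : w ∈ D') :
    ∫ z in D', ‖K z w - K' z w‖ ^ 2 * φ' z ≤ (K' w w).re - (K w w).re := by
  have hmem := hK.mem w (hsub hw)
  -- `K(·, w)` lies in the space of `D'`, so the left side is `‖K(·, w)‖²_{D'} - 2 K(w, w) + K'(w,
  -- w)`, and the first term is at most `‖K(·, w)‖²_D = K(w, w)`.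
  have h := hK'.integral_norm_sq_sub hD' hφ' (hmem.mono hD' hφ' hsub hle) hw 1
  have h2 := hmem.integral_mono hD hφ hD' hφ' hsub hle
  rw [← hK.self_re hD (hsub hw)] at h2
  simp only [one_mul, map_one, norm_one, one_pow] at h
  rw [h]
  linarith

theorem IsReproducingKernel.self_re_le (hD : IsOpen D) (hφ : IsContinuousWeight D φ)
    (hK : IsReproducingKernel D φ K) (hD' : IsOpen D') (hφ' : IsContinuousWeight D' φ')
    (hK' : IsReproducingKernel D' φ' K') (hsub : D' ⊆ D) (hle : ∀ z ∈ D', φ' z ≤ φ z)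
    {w : Fin n → ℂ} (hw : w ∈ D') : (K w w).re ≤ (K' w w).re := by
  have h := hK.integral_norm_sq_sub_le hD hφ hD' hφ' hK' hsub hle hw
  have h2 := integral_norm_sq_nonneg (f := fun z => K z w - K' z w) hD' hφ'
  linarith

theorem IsReproducingKernel.norm_sq_sub_le (hD : IsOpen D) (hφ : IsContinuousWeight D φ)
    (hK : IsReproducingKernel D φ K) (hD' : IsOpen D') (hφ' : IsContinuousWeight D' φ')
    (hK' : IsReproducingKernel D' φ' K') (hsub : D' ⊆ D) (hle : ∀ z ∈ D', φ' z ≤ φ z)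
    {z w : Fin n → ℂ} (hz : z ∈ D') (hw : w ∈ D') :
    ‖K z w - K' z w‖ ^ 2 ≤ (K' z z).re * ((K' w w).re - (K w w).re) :=
  (hK'.norm_sq_le hD' hφ' (((hK.mem w (hsub hw)).mono hD' hφ' hsub hle).sub hD' hφ'
    (hK'.mem w hw)) hz).trans (mul_le_mul_of_nonneg_left
      (hK.integral_norm_sq_sub_le hD hφ hD' hφ' hK' hsub hle hw) (hK'.self_re_nonneg hD' hφ' hz))

/-- The evaluation bound for `K(·, z)` at `z` itself reads `K(z, z)² ≤ C K(z, z)`. -/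
theorem IsReproducingKernel.exists_self_re_le (hD : IsOpen D) (hφ : IsContinuousWeight D φ)
    (hK : IsReproducingKernel D φ K) {z₀ : Fin n → ℂ} (hz₀ : z₀ ∈ D) :
    ∃ r > 0, ∃ C, 0 ≤ C ∧ ball z₀ r ⊆ D ∧ ∀ z ∈ ball z₀ r, (K z z).re ≤ C := by
  obtain ⟨r, hr, C, hC, hsub, hb⟩ := exists_norm_sq_le hD hφ.continuousOn hφ.pos hz₀
  refine ⟨r, hr, C, hC, hsub, fun z hz => ?_⟩
  have h := hb _ (hK.mem z (hsub hz)) z hz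
  rw [← hK.self_re hD (hsub hz), hK.self_eq (hsub hz), Complex.norm_real, Real.norm_eq_abs, sq_abs,
    Complex.ofReal_re] at h
  rcases (hK.self_re_nonneg hD hφ (hsub hz)).eq_or_lt with h0 | h0
  · rw [← h0]; exact hC
  · exact le_of_mul_le_mul_right (by linarith) h0

/-- Coordinatewise conjugation of the second variable, as a real-linear isometry. -/
noncomputable def conjSnd (n : ℕ) : ((Fin n → ℂ) × (Fin n → ℂ)) ≃ₗᵢ[ℝ] ((Fin n → ℂ) × (Fin n → ℂ)) where
  toLinearEquiv := (LinearEquiv.refl ℝ (Fin n → ℂ)).prodCongr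
    (starL' ℝ (A := Fin n → ℂ)).toLinearEquiv
  norm_map' := fun p => by
    simp [Prod.norm_def]

@[simp] theorem conjSnd_apply (p : (Fin n → ℂ) × (Fin n → ℂ)) : conjSnd n p = (p.1, star p.2) := rfl

/-- Reproducing kernels are holomorphic in the first and the conjugate of the second variable. -/
theorem IsReproducingKernel.differentiableAt_conjSnd (hD : IsOpen D) (hφ : IsContinuousWeight D φ)
    (hK : IsReproducingKernel D φ K) {z w : Fin n → ℂ} (hz : z ∈ D) (hw : star w ∈ D) :
    DifferentiableAt ℂ (fun p : (Fin n → ℂ) × (Fin n → ℂ) => K p.1 (star p.2)) (z, w) := by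
  obtain ⟨r₁, hr₁, C₁, hC₁, hs₁, hb₁⟩ := hK.exists_self_re_le hD hφ hz
  obtain ⟨r₂, hr₂, C₂, hC₂, hs₂, hb₂⟩ := hK.exists_self_re_le hD hφ hw
  obtain ⟨r, hr, h1, h2⟩ : ∃ r > 0, 2 * r ≤ r₁ ∧ 2 * r ≤ r₂ :=
    ⟨min r₁ r₂ / 2, by positivity, by linarith [min_le_left r₁ r₂], by linarith [min_le_right r₁ r₂]⟩
  have hstar : ∀ u ∈ ball w (2 * r), star u ∈ ball (star w) r₂ := fun u hu => by
    rw [mem_ball, dist_eq_norm] at hu ⊢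
    rw [← star_sub, norm_star]
    linarith
  have hball : ball z (2 * r) ⊆ ball z r₁ := ball_subset_ball h1
  refine differentiableAt_of_separately (H := fun z w => K z (star w)) (C := √(C₁ * C₂)) hr
    (fun u hu => ((hK.mem _ (hs₂ (hstar u hu))).1).mono (hball.trans hs₁)) (fun v hv u hu => ?_)
    fun v hv u hu => ?_
  · refine DifferentiableAt.differentiableWithinAt ?_
    -- By anti-symmetry `u ↦ K(v, ū)` is the conjugate of `K(·, v)` at the conjugate point, hence
    -- holomorphic.
    have hd : DifferentiableAt ℂ (fun x => K x v) (star u) :=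
      (hK.mem v (hs₁ (hball hv))).1.differentiableAt (hD.mem_nhds (hs₂ (hstar u hu)))
    have hd' := hd.star_star
    rw [star_star] at hd'
    refine hd'.congr_of_eventuallyEq ?_
    filter_upwards [isOpen_ball.mem_nhds hu] with y hy
    exact hK.symm v (hs₁ (hball hv)) (star y) (hs₂ (hstar y hy))
  · refine Real.le_sqrt_of_sq_le ?_
    refine (hK.norm_sq_kernel_le hD hφ (hs₁ (hball hv)) (hs₂ (hstar u hu))).trans ?_
    exact mul_le_mul (hb₁ _ (hball hv)) (hb₂ _ (hstar u hu))
      (hK.self_re_nonneg hD hφ (hs₂ (hstar u hu))) hC₁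

theorem IsReproducingKernel.contDiffOn (hD : IsOpen D) (hφ : IsContinuousWeight D φ)
    (hK : IsReproducingKernel D φ K) :
    ContDiffOn ℝ ∞ (fun p : (Fin n → ℂ) × (Fin n → ℂ) => K p.1 p.2) (D ×ˢ D) := by
  have hopen : IsOpen (conjSnd n ⁻¹' (D ×ˢ D)) := (hD.prod hD).preimage (conjSnd n).continuous
  have h := (contDiffOn_of_differentiableOn_complex hopen (f := fun p => K p.1 (star p.2))
    fun p hp => (hK.differentiableAt_conjSnd hD hφ hp.1 hp.2).differentiableWithinAt).restrict_scalars
      ℝ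
  have h2 := h.comp (conjSnd n).contDiff.contDiffOn (s := D ×ˢ D) fun p hp => by simpa using hp
  refine h2.congr fun p hp => ?_
  simp

theorem IsReproducingKernel.continuousOn_self_re (hD : IsOpen D) (hφ : IsContinuousWeight D φ)
    (hK : IsReproducingKernel D φ K) : ContinuousOn (fun z => (K z z).re) D :=
  Complex.continuous_re.comp_continuousOn ((hK.contDiffOn hD hφ).continuousOn.comp
    (f := fun z => (z, z)) (by fun_prop) fun z hz => ⟨hz, hz⟩)

theorem IsReproducingKernel.const_mul {c : ℝ} (hc : 0 < c) (hK : IsReproducingKernel D φ K) :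
    IsReproducingKernel D (fun z => c * φ z) (fun z w => (c⁻¹ : ℂ) * K z w) := by
  have hc' : (c : ℂ) ≠ 0 := by exact_mod_cast hc.ne'
  have hmem : ∀ f, MemWeightedBergman D (fun z => c * φ z) f ↔ MemWeightedBergman D φ f := by
    intro f
    refine and_congr_right fun _ => ?_
    have : (fun z => ‖f z‖ ^ 2 * (c * φ z)) = fun z => c * (‖f z‖ ^ 2 * φ z) := by
      funext z; ring
    rw [this]
    exact integrable_const_mul_iff (isUnit_iff_ne_zero.2 hc.ne') _
  refine ⟨fun w hw => (hmem _).2 ⟨(hK.mem w hw).1.const_mul _, ?_⟩, fun z hz w hw => ?_,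
    fun f hf z hz => ?_⟩
  · simp_rw [norm_mul, mul_pow, mul_assoc]
    exact (hK.mem w hw).2.const_mul _
  · rw [map_mul, ← hK.symm z hz w hw, map_inv₀, Complex.conj_ofReal]
  · rw [hK.reproduces f ((hmem f).1 hf) z hz]
    refine congrArg _ (funext fun w => ?_)
    push_cast
    field_simp

end ReproducingKernel

/-! ### Approximation of the kernel from inside -/

section Exhaustion

open Metric

variable {n : ℕ} {D D' : Set (Fin n → ℂ)} {φ : (Fin n → ℂ) → ℝ}
  {K : (Fin n → ℂ) → (Fin n → ℂ) → ℂ}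

theorem IsContinuousWeight.mono (hφ : IsContinuousWeight D φ) (h : D' ⊆ D) :
    IsContinuousWeight D' φ :=
  ⟨hφ.continuousOn.mono h, fun z hz => hφ.pos z (h hz)⟩

theorem IsContinuousWeight.const_mul (hφ : IsContinuousWeight D φ) {c : ℝ} (hc : 0 < c) :
    IsContinuousWeight D (fun z => c * φ z) :=
  ⟨continuousOn_const.mul hφ.continuousOn, fun z hz => mul_pos hc (hφ.pos z hz)⟩

/-- The kernels of an increasing exhaustion converge on the diagonal. -/
theorem tendsto_self_re_of_exhaustion (hD : IsOpen D) (hφ : IsContinuousWeight D φ)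
    (hK : IsReproducingKernel D φ K) {U : ℕ → Set (Fin n → ℂ)} (hU : ∀ m, IsOpen (U m))
    (hmono : Monotone U) (hUD : ∀ m, U m ⊆ D) (hcov : ∀ z ∈ D, ∃ m, z ∈ U m)
    {k : ℕ → (Fin n → ℂ) → (Fin n → ℂ) → ℂ} (hk : ∀ m, IsReproducingKernel (U m) φ (k m))
    {w : Fin n → ℂ} (hw : ∀ m, w ∈ U m) :
    Tendsto (fun m => (k m w w).re) atTop (𝓝 (K w w).re) := by
  have hφU : ∀ m, IsContinuousWeight (U m) φ := fun m => hφ.mono (hUD m)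
  have hwD : w ∈ D := hUD 0 (hw 0)
  set a : ℕ → ℝ := fun m => (k m w w).re
  have hle : ∀ {m l}, m ≤ l → ∀ z ∈ U m, (k l z z).re ≤ (k m z z).re := fun {m l} h z hz =>
    (hk l).self_re_le (hU l) (hφU l) (hU m) (hφU m) (hk m) (hmono h) (fun _ _ => le_rfl) hz
  have hanti : Antitone a := fun m l h => hle h w (hw m)
  have hbdd : ∀ m, (K w w).re ≤ a m := fun m =>
    hK.self_re_le hD hφ (hU m) (hφU m) (hk m) (hUD m) (fun _ _ => le_rfl) (hw m)
  obtain ⟨L, hL⟩ : ∃ L, Tendsto a atTop (𝓝 L) :=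
    ⟨_, tendsto_atTop_ciInf hanti ⟨(K w w).re, by rintro _ ⟨m, rfl⟩; exact hbdd m⟩⟩
  have hKL : (K w w).re ≤ L := ge_of_tendsto' hL hbdd
  have hLa : ∀ m, L ≤ a m := fun m => hanti.le_of_tendsto hL m
  -- For `m ≤ l`, `|k_l - k_m|²(x, w) ≤ k_m(x, x) (a_m - a_l)`: convergence of the decreasing values
  -- `a_m` makes `k_m(·, w)` locally uniformly Cauchy.
  have hunif : ∀ z ∈ D, ∃ r > 0, ∃ m₀, ball z r ⊆ U m₀ ∧
      UniformCauchySeqOn (fun m x => k m x w) atTop (ball z r) := by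
    intro z hz
    obtain ⟨m₀, hm₀⟩ := hcov z hz
    obtain ⟨r, hr, C, hC, hsub, hb⟩ := (hk m₀).exists_self_re_le (hU m₀) (hφU m₀) hm₀
    refine ⟨r, hr, m₀, hsub, Metric.uniformCauchySeqOn_iff.2 fun ε hε => ?_⟩
    have hev : ∀ᶠ m in atTop, a m < L + ε ^ 2 / (C + 1) :=
      hL.eventually_lt_const (lt_add_of_pos_right _ (by positivity))
    obtain ⟨N, hN, hmN⟩ := (hev.and (eventually_ge_atTop m₀)).exists
    have key : ∀ m l, N ≤ m → m ≤ l → ∀ x ∈ ball z r, ‖k l x w - k m x w‖ < ε := by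
      intro m l hm hml x hx
      have hxm := hmono (hmN.trans hm) (hsub hx)
      have h1 := (hk l).norm_sq_sub_le (hU l) (hφU l) (hU m) (hφU m) (hk m) (hmono hml)
        (fun _ _ => le_rfl) hxm (hw m)
      have h2 : (k m x x).re ≤ C := (hle (hmN.trans hm) x (hsub hx)).trans (hb x hx)
      have h3 : a m - a l < ε ^ 2 / (C + 1) := by
        have h6 : a m ≤ a N := hanti hm
        have h7 := hLa l
        linarith
      have h4 : 0 ≤ a m - a l := sub_nonneg.2 (hanti hml)
      rw [lt_div_iff₀ (by positivity)] at h3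
      refine lt_of_pow_lt_pow_left₀ 2 hε.le ?_
      have h5 : (k m x x).re * (a m - a l) ≤ C * (a m - a l) := mul_le_mul_of_nonneg_right h2 h4
      linarith
    refine ⟨N, fun m hm l hl x hx => ?_⟩
    rw [dist_eq_norm]
    rcases le_total m l with h | h
    · rw [norm_sub_rev]; exact key m l hm h x hx
    · exact key l m hl h x hx
  have hpt : ∀ z ∈ D, ∃ b, Tendsto (fun m => k m z w) atTop (𝓝 b) := fun z hz => by
    obtain ⟨r, hr, -, -, h⟩ := hunif z hz
    exact cauchySeq_tendsto_of_complete (h.cauchySeq (mem_ball_self hr))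
  choose! F hF using hpt
  have hFd : DifferentiableOn ℂ F D := fun z hz => by
    obtain ⟨r, hr, m₀, hsub, h⟩ := hunif z hz
    refine (differentiableAt_of_tendstoUniformlyOn_ball hr ?_ (h.tendstoUniformlyOn_of_tendsto
      fun x hx => hF x (hUD m₀ (hsub hx)))).differentiableWithinAt
    filter_upwards [eventually_ge_atTop m₀] with m hm
    exact ((hk m).mem w (hw m)).1.mono (hsub.trans (hmono hm))
  have hFw : F w = (L : ℂ) := by
    refine tendsto_nhds_unique (hF w hwD) ?_
    have : (fun m => k m w w) = fun m => ((a m : ℝ) : ℂ) := funext fun m => (hk m).self_eq (hw m)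
    rw [this]
    exact (Complex.continuous_ofReal.tendsto L).comp hL
  have hnonneg : ∀ᵐ z ∂volume.restrict D, 0 ≤ ‖F z‖ ^ 2 * φ z := by
    filter_upwards [ae_restrict_mem hD.measurableSet] with z hz
    exact mul_nonneg (by positivity) (hφ.pos z hz).le
  have hmeas : AEStronglyMeasurable (fun z => ‖F z‖ ^ 2 * φ z) (volume.restrict D) :=
    ((hFd.continuousOn.norm.pow 2).mul hφ.continuousOn).aestronglyMeasurable hD.measurableSet
  have hkint : ∀ m, ∫⁻ z in U m, ENNReal.ofReal (‖k m z w‖ ^ 2 * φ z) = ENNReal.ofReal (a m) := by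
    intro m
    rw [← ofReal_integral_eq_lintegral_ofReal ((hk m).mem w (hw m)).2, ← (hk m).self_re (hU m) (hw m)]
    filter_upwards [ae_restrict_mem (hU m).measurableSet] with z hz
    exact mul_nonneg (by positivity) (hφ.pos z (hUD m hz)).le
  -- Fatou's lemma gives `‖F‖² ≤ L`, whereas `F(w) = L`.
  have hfatou : ∫⁻ z in D, ENNReal.ofReal (‖F z‖ ^ 2 * φ z) ≤ ENNReal.ofReal L := by
    set G : ℕ → (Fin n → ℂ) → ENNReal := fun m =>
      (U m).indicator fun z => ENNReal.ofReal (‖k m z w‖ ^ 2 * φ z)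
    have hGint : ∀ m, ∫⁻ z in D, G m z = ENNReal.ofReal (a m) := fun m => by
      rw [← hkint m, setLIntegral_indicator (hU m).measurableSet,
        Set.inter_eq_left.2 (hUD m)]
    have hGm : ∀ m, AEMeasurable (G m) (volume.restrict D) := fun m => by
      refine AEMeasurable.mono_measure ?_ Measure.restrict_le_self
      rw [aemeasurable_indicator_iff (hU m).measurableSet]
      exact (((hk m).mem w (hw m)).2.aestronglyMeasurable.aemeasurable).ennreal_ofReal
    have hlim : ∀ z ∈ D, ENNReal.ofReal (‖F z‖ ^ 2 * φ z) = liminf (fun m => G m z) atTop := by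
      intro z hz
      refine (Tendsto.liminf_eq ?_).symm
      have h1 : Tendsto (fun m => ENNReal.ofReal (‖k m z w‖ ^ 2 * φ z)) atTop
          (𝓝 (ENNReal.ofReal (‖F z‖ ^ 2 * φ z))) :=
        (ENNReal.continuous_ofReal.tendsto _).comp (((hF z hz).norm.pow 2).mul_const _)
      refine h1.congr' ?_
      obtain ⟨m₀, hm₀⟩ := hcov z hz
      filter_upwards [eventually_ge_atTop m₀] with m hm
      simp only [G, Set.indicator_of_mem (hmono hm hm₀)]
    calc ∫⁻ z in D, ENNReal.ofReal (‖F z‖ ^ 2 * φ z)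
        = ∫⁻ z in D, liminf (fun m => G m z) atTop :=
          setLIntegral_congr_fun hD.measurableSet hlim
      _ ≤ liminf (fun m => ∫⁻ z in D, G m z) atTop := lintegral_liminf_le' hGm
      _ = ENNReal.ofReal L := by
          simp_rw [hGint]
          exact ((ENNReal.continuous_ofReal.tendsto _).comp hL).liminf_eq
  have hFmem : MemWeightedBergman D φ F := by
    refine ⟨hFd, hmeas, ?_⟩
    rw [hasFiniteIntegral_iff_ofReal hnonneg]
    exact hfatou.trans_lt ENNReal.ofReal_lt_top
  have hL0 : 0 ≤ L := (hK.self_re_nonneg hD hφ hwD).trans hKL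
  have hN : ∫ z in D, ‖F z‖ ^ 2 * φ z ≤ L := by
    rw [← ENNReal.ofReal_le_ofReal_iff hL0, ofReal_integral_eq_lintegral_ofReal hFmem.2 hnonneg]
    exact hfatou
  -- Now `0 ≤ ‖F - K(·, w)‖² ≤ L - 2 L + K(w, w)`, so `L ≤ K(w, w)`.
  have h1 := hK.integral_norm_sq_sub hD hφ hFmem hwD 1
  have h2 := integral_norm_sq_nonneg (f := fun z => F z - 1 * K z w) hD hφ
  rw [h1, hFw, map_one, one_mul, Complex.ofReal_re, norm_one] at h2
  have : L = (K w w).re := le_antisymm (by linarith) hKL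
  rwa [← this]

/-- The diagonal of the kernel is approximated from above by relatively compact subdomains. -/
theorem exists_isCompact_self_re_lt (hD : IsOpen D) (hφ : IsContinuousWeight D φ)
    (hK : IsReproducingKernel D φ K) {w : Fin n → ℂ} (hw : w ∈ D) {η : ℝ} (hη : 0 < η) :
    ∃ S U k, IsCompact S ∧ S ⊆ D ∧ IsOpen U ∧ U ⊆ S ∧ w ∈ U ∧ IsReproducingKernel U φ k ∧
      (k w w).re < (K w w).re + η := by
  -- Removing the closed thickening of the complement leaves an open set, removing the open one
  -- leaves a compact set: `V m ⊆ S m ⊆ D`.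
  let V : ℕ → Set (Fin n → ℂ) := fun m =>
    ball 0 ((m : ℝ) + 1) \ cthickening (1 / ((m : ℝ) + 1)) Dᶜ
  let S : ℕ → Set (Fin n → ℂ) := fun m =>
    closedBall 0 ((m : ℝ) + 1) \ thickening (1 / ((m : ℝ) + 1)) Dᶜ
  have hVo : ∀ m, IsOpen (V m) := fun m => isOpen_ball.sdiff isClosed_cthickening
  have hVS : ∀ m, V m ⊆ S m := fun m =>
    Set.sdiff_subset_sdiff ball_subset_closedBall (thickening_subset_cthickening _ _)
  have hSc : ∀ m, IsCompact (S m) := fun m => (isCompact_closedBall _ _).diff isOpen_thickening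
  have hSD : ∀ m, S m ⊆ D := fun m z hz => by
    by_contra h
    exact hz.2 (self_subset_thickening (by positivity) _ h)
  have hVm : Monotone V := fun m l h => by
    have h' : (m : ℝ) ≤ l := by exact_mod_cast h
    refine Set.sdiff_subset_sdiff (ball_subset_ball (by linarith)) (cthickening_mono ?_ _)
    exact one_div_le_one_div_of_le (by positivity) (by linarith)
  have hVcov : ∀ z ∈ D, ∃ m, z ∈ V m := fun z hz => by
    have h1 : z ∉ closure Dᶜ := by
      rw [hD.isClosed_compl.closure_eq]; exact fun h => h hz
    rw [closure_eq_iInter_cthickening] at h1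
    simp only [Set.mem_iInter, not_forall] at h1
    obtain ⟨δ, hδ, hzδ⟩ := h1
    obtain ⟨m₁, hm₁⟩ := exists_nat_one_div_lt hδ
    obtain ⟨m₂, hm₂⟩ := exists_nat_gt ‖z‖
    refine ⟨max m₁ m₂, ?_, fun h => hzδ (cthickening_mono ?_ _ h)⟩
    · rw [mem_ball_zero_iff]
      have : (m₂ : ℝ) ≤ (max m₁ m₂ : ℕ) := by exact_mod_cast le_max_right _ _
      linarith
    · refine le_trans (one_div_le_one_div_of_le (by positivity) ?_) hm₁.le
      have : (m₁ : ℝ) ≤ (max m₁ m₂ : ℕ) := by exact_mod_cast le_max_left _ _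
      linarith
  obtain ⟨m₀, hm₀⟩ := hVcov w hw
  choose k hk using fun m => exists_isReproducingKernel (hVo (m + m₀))
    (hφ.mono ((hVS (m + m₀)).trans (hSD _)))
  have hlim := tendsto_self_re_of_exhaustion hD hφ hK (U := fun m => V (m + m₀))
    (fun m => hVo _) (fun m l h => hVm (by lia)) (fun m => (hVS _).trans (hSD _))
    (fun z hz => by
      obtain ⟨m, hm⟩ := hVcov z hz
      exact ⟨m, hVm (by lia) hm⟩) hk (w := w) (fun m => hVm (by lia) hm₀)
  obtain ⟨m, hm⟩ := (hlim.eventually_lt_const (lt_add_of_pos_right _ hη)).exists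
  exact ⟨S (m + m₀), V (m + m₀), k m, hSc _, hSD _, hVo _, hVS _, hVm (by lia) hm₀, hk m, hm⟩

end Exhaustion

/-! ### Change of variables under homotheties -/

section Dilation

variable {n : ℕ} {D : Set (Fin n → ℂ)} {φ : (Fin n → ℂ) → ℝ}
  {K : (Fin n → ℂ) → (Fin n → ℂ) → ℂ}

/-- The homothety with centre `q` and ratio `t`. -/
noncomputable def homothety (q : Fin n → ℂ) (t : ℝ) (z : Fin n → ℂ) : Fin n → ℂ :=
  q + t • (z - q)

theorem homothety_homothety (q : Fin n → ℂ) (s t : ℝ) (z : Fin n → ℂ) :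
    homothety q s (homothety q t z) = homothety q (s * t) z := by
  simp [homothety, smul_smul]

theorem homothety_one (q z : Fin n → ℂ) : homothety q 1 z = z := by simp [homothety]

theorem differentiable_homothety (q : Fin n → ℂ) (t : ℝ) : Differentiable ℂ (homothety q t) := by
  unfold homothety
  simp_rw [← Complex.coe_smul t]
  fun_prop

variable (q : Fin n → ℂ) {t : ℝ}

theorem homothety_inv_homothety (ht : 0 < t) (z : Fin n → ℂ) :
    homothety q t⁻¹ (homothety q t z) = z := by
  rw [homothety_homothety, inv_mul_cancel₀ ht.ne', homothety_one]

theorem homothety_homothety_inv (ht : 0 < t) (z : Fin n → ℂ) :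
    homothety q t (homothety q t⁻¹ z) = z := by
  rw [homothety_homothety, mul_inv_cancel₀ ht.ne', homothety_one]

/-- The Jacobian determinant of a homothety of ratio `t` of `ℂⁿ`. -/
noncomputable def homothetyJacobian (n : ℕ) (t : ℝ) : ℝ := t ^ Module.finrank ℝ (Fin n → ℂ)

theorem homothetyJacobian_pos (ht : 0 < t) : 0 < homothetyJacobian n t := pow_pos ht _

/-- The dilate of `D` by `t` is written as the preimage under the inverse homothety. With indicators
the claim becomes translation and scaling of integrals over the whole space. -/
theorem setIntegral_preimage_homothety {F : Type*} [NormedAddCommGroup F] [NormedSpace ℝ F]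
    (hD : IsOpen D) (ht : 0 < t) (g : (Fin n → ℂ) → F) :
    ∫ z in homothety q t⁻¹ ⁻¹' D, g (homothety q t⁻¹ z) =
      homothetyJacobian n t • ∫ z in D, g z := by
  have hc : Continuous (homothety q t⁻¹) := (differentiable_homothety q _).continuous
  rw [← integral_indicator (hD.preimage hc).measurableSet, ← integral_indicator hD.measurableSet]
  have h1 : (homothety q t⁻¹ ⁻¹' D).indicator (fun z => g (homothety q t⁻¹ z)) =
      fun z => D.indicator g (q + t⁻¹ • (z - q)) := by
    funext z
    rfl
  rw [h1, integral_sub_right_eq_self (fun z => D.indicator g (q + t⁻¹ • z)) q,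
    Measure.integral_comp_smul volume (fun z => D.indicator g (q + z)) t⁻¹,
    integral_add_left_eq_self (D.indicator g) q]
  rw [homothetyJacobian, inv_pow, inv_inv, abs_of_pos (pow_pos ht _)]

theorem integrableOn_preimage_homothety {F : Type*} [NormedAddCommGroup F] [NormedSpace ℝ F]
    (hD : IsOpen D) (ht : 0 < t) (g : (Fin n → ℂ) → F) :
    IntegrableOn (fun z => g (homothety q t⁻¹ z)) (homothety q t⁻¹ ⁻¹' D) ↔ IntegrableOn g D := by
  have hc : Continuous (homothety q t⁻¹) := (differentiable_homothety q _).continuous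
  rw [← integrable_indicator_iff (hD.preimage hc).measurableSet,
    ← integrable_indicator_iff hD.measurableSet]
  have h1 : (homothety q t⁻¹ ⁻¹' D).indicator (fun z => g (homothety q t⁻¹ z)) =
      fun z => D.indicator g (q + t⁻¹ • (z - q)) := by
    funext z
    rfl
  rw [h1]
  constructor
  · intro h
    have h2 := h.comp_add_right q
    simp only [add_sub_cancel_right] at h2
    have h3 := (integrable_comp_smul_iff volume (fun z => D.indicator g (q + z))
      (inv_ne_zero ht.ne')).1 h2
    simpa using h3.comp_sub_right q |>.congr (Eventually.of_forall fun z => by simp)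
  · intro h
    exact ((integrable_comp_smul_iff volume (fun z => D.indicator g (q + z))
      (inv_ne_zero ht.ne')).2 (h.comp_add_left q)).comp_sub_right q

theorem memWeightedBergman_preimage_homothety (hD : IsOpen D) (ht : 0 < t)
    (f : (Fin n → ℂ) → ℂ) :
    MemWeightedBergman (homothety q t⁻¹ ⁻¹' D) (fun z => φ (homothety q t⁻¹ z))
      (fun z => f (homothety q t⁻¹ z)) ↔ MemWeightedBergman D φ f := by
  refine and_congr ⟨fun h => ?_, fun h => ?_⟩
    (integrableOn_preimage_homothety q hD ht (fun z => ‖f z‖ ^ 2 * φ z))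
  · have h2 := h.comp (differentiable_homothety q t).differentiableOn (s := D) fun z hz => by
      rwa [Set.mem_preimage, homothety_inv_homothety q ht]
    refine h2.congr fun z _ => ?_
    rw [Function.comp_apply, homothety_inv_homothety q ht]
  · exact h.comp (differentiable_homothety q t⁻¹).differentiableOn fun z hz => hz

/-- Transformation of the kernel under homotheties. -/
theorem IsReproducingKernel.homothety (hD : IsOpen D) (ht : 0 < t)
    (hK : IsReproducingKernel D φ K) :
    IsReproducingKernel (homothety q t⁻¹ ⁻¹' D) (fun z => φ (homothety q t⁻¹ z))
      (fun z w => ((homothetyJacobian n t)⁻¹ : ℂ) * K (homothety q t⁻¹ z) (homothety q t⁻¹ w)) := by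
  have hJ : (homothetyJacobian n t : ℂ) ≠ 0 := by
    exact_mod_cast (homothetyJacobian_pos ht).ne'
  refine ⟨fun w hw => ?_, fun z hz w hw => ?_, fun f hf z hz => ?_⟩
  · refine (memWeightedBergman_preimage_homothety q hD ht
      (fun z => ((homothetyJacobian n t)⁻¹ : ℂ) * K z (_root_.homothety q t⁻¹ w))).2 ?_
    refine ⟨(hK.mem _ hw).1.const_mul _, ?_⟩
    simp_rw [norm_mul, mul_pow, mul_assoc]
    exact (hK.mem _ hw).2.const_mul _
  · rw [map_mul, ← hK.symm _ hz _ hw, map_inv₀, Complex.conj_ofReal]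
  · have hf' : MemWeightedBergman D φ (fun z => f (_root_.homothety q t z)) := by
      rw [← memWeightedBergman_preimage_homothety q hD ht]
      simpa only [homothety_homothety_inv q ht] using hf
    have h := hK.reproduces _ hf' _ hz
    rw [homothety_homothety_inv q ht] at h
    have h2 := setIntegral_preimage_homothety q hD ht (fun w =>
      K (_root_.homothety q t⁻¹ z) w * f (_root_.homothety q t w) * (φ w : ℂ))
    simp only [homothety_homothety_inv q ht] at h2
    simp_rw [mul_assoc] at h h2 ⊢
    rw [integral_const_mul, h2, ← h, Complex.real_smul, inv_mul_cancel_left₀ hJ]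

end Dilation

/-! ### Convergence of kernels for converging weighted domains -/

section Convergence

open Metric

variable {n : ℕ}

/-- Data for the convergence of kernels: the weighted domains `(Dj j, φj j)` contain the compact
subsets of `(D, φ)` in the limit, and are contained in its dilations with ratio close to one. -/
structure KernelConvergence {n : ℕ} (d : ℕ) (q : Fin n → ℂ) (D : Set (Fin n → ℂ))
    (φ : (Fin n → ℂ) → ℝ) (K : (Fin n → ℂ) → (Fin n → ℂ) → ℂ) (Dj : ℕ → Set (Fin n → ℂ))
    (φj : ℕ → (Fin n → ℂ) → ℝ) (Kj : ℕ → (Fin n → ℂ) → (Fin n → ℂ) → ℂ) : Prop where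
  isOpen : IsOpen D
  weight : IsContinuousWeight D φ
  kernel : IsReproducingKernel D φ K
  isOpen_seq : ∀ j, IsOpen (Dj j)
  weight_seq : ∀ᶠ j in atTop, IsContinuousWeight (Dj j) (φj j)
  kernel_seq : ∀ᶠ j in atTop, IsReproducingKernel (Dj j) (φj j) (Kj j)
  exhausts : ∀ S, IsCompact S → S ⊆ D → ∀ᶠ j in atTop, S ⊆ Dj j
  weight_le : ∀ S, IsCompact S → S ⊆ D → ∀ c, 0 < c → c < 1 →
    ∀ᶠ j in atTop, ∀ z ∈ S, c * φ z ≤ φj j z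
  dilation : ∀ t, 1 < t → ∀ᶠ j in atTop, Dj j ⊆ homothety q t⁻¹ ⁻¹' D ∧
    ∀ z ∈ Dj j, φj j z ≤ homothetyJacobian n t ^ d * φ (homothety q t⁻¹ z)

variable {d : ℕ} {q : Fin n → ℂ} {D : Set (Fin n → ℂ)} {φ : (Fin n → ℂ) → ℝ}
  {K : (Fin n → ℂ) → (Fin n → ℂ) → ℂ} {Dj : ℕ → Set (Fin n → ℂ)} {φj : ℕ → (Fin n → ℂ) → ℝ}
  {Kj : ℕ → (Fin n → ℂ) → (Fin n → ℂ) → ℂ}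

namespace KernelConvergence

/-- Inner comparison: `c⁻¹ k` is the kernel of `U` with weight `c φ`, and this weight is eventually
below that of `D_j` on `U`. -/
theorem eventually_self_re_le (h : KernelConvergence d q D φ K Dj φj Kj) {S U : Set (Fin n → ℂ)}
    (hS : IsCompact S) (hSD : S ⊆ D) (hU : IsOpen U) (hUS : U ⊆ S)
    {k : (Fin n → ℂ) → (Fin n → ℂ) → ℂ} (hk : IsReproducingKernel U φ k) {c : ℝ} (hc : 0 < c)
    (hc1 : c < 1) : ∀ᶠ j in atTop, U ⊆ Dj j ∧ ∀ z ∈ U, (Kj j z z).re ≤ c⁻¹ * (k z z).re := by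
  filter_upwards [h.exhausts S hS hSD, h.weight_le S hS hSD c hc hc1, h.weight_seq, h.kernel_seq]
    with j h1 h2 h3 h4
  refine ⟨hUS.trans h1, fun z hz => ?_⟩
  have := h4.self_re_le (h.isOpen_seq j) h3 hU ((h.weight.mono (hUS.trans hSD)).const_mul hc)
    (hk.const_mul hc) (hUS.trans h1) (fun z hz => h2 z (hUS hz)) hz
  rwa [← Complex.ofReal_inv, Complex.re_ofReal_mul] at this

/-- The upper half of the squeeze: take `U` whose kernel at `w` is within `η`, then `c` close enough
to `1`. -/
theorem eventually_self_re_lt (h : KernelConvergence d q D φ K Dj φj Kj) {w : Fin n → ℂ}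
    (hw : w ∈ D) {η : ℝ} (hη : 0 < η) : ∀ᶠ j in atTop, (Kj j w w).re < (K w w).re + η := by
  obtain ⟨S, U, k, hS, hSD, hU, hUS, hwU, hk, hlt⟩ :=
    exists_isCompact_self_re_lt h.isOpen h.weight h.kernel hw hη
  have hlim : Tendsto (fun c : ℝ => c⁻¹ * (k w w).re) (𝓝[<] 1) (𝓝 (k w w).re) := by
    have : Tendsto (fun c : ℝ => c⁻¹ * (k w w).re) (𝓝 1) (𝓝 ((1 : ℝ)⁻¹ * (k w w).re)) :=
      (tendsto_inv₀ one_ne_zero).mul_const _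
    rw [inv_one, one_mul] at this
    exact this.mono_left nhdsWithin_le_nhds
  obtain ⟨c, hc, hc0, hc1⟩ := ((hlim.eventually_lt_const hlt).and
    (Ioo_mem_nhdsLT (zero_lt_one' ℝ))).exists
  filter_upwards [h.eventually_self_re_le hS hSD hU hUS hk hc0 hc1] with j hj
  exact (hj.2 w hwU).trans_lt hc

/-- Comparison with the kernel of one fixed ball in `D`, with `c = 1 / 2`, gives a bound independent
of `j`. -/
theorem exists_eventually_self_re_le (h : KernelConvergence d q D φ K Dj φj Kj) {z₀ : Fin n → ℂ}
    (hz₀ : z₀ ∈ D) : ∃ r > 0, ∃ C, 0 ≤ C ∧ ball z₀ r ⊆ D ∧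
      ∀ᶠ j in atTop, ball z₀ r ⊆ Dj j ∧ ∀ z ∈ ball z₀ r, (Kj j z z).re ≤ C := by
  obtain ⟨R, hR, hRD⟩ := Metric.nhds_basis_closedBall.mem_iff.1 (h.isOpen.mem_nhds hz₀)
  have hw := h.weight.mono (ball_subset_closedBall.trans hRD)
  obtain ⟨k, hk⟩ := exists_isReproducingKernel isOpen_ball hw
  obtain ⟨r, hr, C, hC, hsub, hb⟩ := hk.exists_self_re_le isOpen_ball hw (mem_ball_self hR)
  refine ⟨r, hr, (1 / 2 : ℝ)⁻¹ * C, by positivity,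
    hsub.trans (ball_subset_closedBall.trans hRD), ?_⟩
  filter_upwards [h.eventually_self_re_le (isCompact_closedBall _ _) hRD isOpen_ball
    ball_subset_closedBall hk (c := 1 / 2) (by norm_num) (by norm_num)] with j hj
  exact ⟨hsub.trans hj.1, fun z hz => (hj.2 z (hsub hz)).trans
    (mul_le_mul_of_nonneg_left (hb z hz) (by norm_num))⟩

/-- The function of `t` is the kernel of the dilated domain with the dominating weight from
`KernelConvergence.dilation`, the outer competitor in the squeeze. -/
theorem tendsto_dilated_kernel (hD : IsOpen D) (hφ : IsContinuousWeight D φ)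
    (hK : IsReproducingKernel D φ K) {z w : Fin n → ℂ} (hz : z ∈ D) (hw : w ∈ D) :
    Tendsto (fun t : ℝ => ((homothetyJacobian n t ^ d : ℝ) : ℂ)⁻¹ *
      (((homothetyJacobian n t)⁻¹ : ℂ) * K (homothety q t⁻¹ z) (homothety q t⁻¹ w)))
      (𝓝[>] 1) (𝓝 (K z w)) := by
  refine Tendsto.mono_left ?_ nhdsWithin_le_nhds
  have hJ : ContinuousAt (fun t : ℝ => homothetyJacobian n t) 1 := by
    unfold homothetyJacobian; fun_prop
  have hJ1 : homothetyJacobian n 1 = 1 := by simp [homothetyJacobian]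
  have hp : ContinuousAt (fun t : ℝ => (homothety q t⁻¹ z, homothety q t⁻¹ w)) 1 := by
    have : ContinuousAt (fun t : ℝ => t⁻¹) 1 := continuousAt_inv₀ one_ne_zero
    unfold homothety
    fun_prop
  have hK1 : ContinuousAt (fun p : (Fin n → ℂ) × (Fin n → ℂ) => K p.1 p.2)
      (homothety q (1 : ℝ)⁻¹ z, homothety q (1 : ℝ)⁻¹ w) := by
    rw [inv_one, homothety_one, homothety_one]
    exact (hK.contDiffOn hD hφ).continuousOn.continuousAt ((hD.prod hD).mem_nhds ⟨hz, hw⟩)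
  have hJc : ContinuousAt (fun t : ℝ => ((homothetyJacobian n t : ℝ) : ℂ)⁻¹) 1 :=
    (Complex.continuous_ofReal.continuousAt.comp hJ).inv₀ (by simp [hJ1])
  have hJd : ContinuousAt (fun t : ℝ => ((homothetyJacobian n t ^ d : ℝ) : ℂ)⁻¹) 1 :=
    (Complex.continuous_ofReal.continuousAt.comp (hJ.pow d)).inv₀ (by simp [hJ1])
  have := hJd.mul (hJc.mul (ContinuousAt.comp (x := (1 : ℝ)) hK1 hp))
  have e : K z w = ((homothetyJacobian n 1 ^ d : ℝ) : ℂ)⁻¹ * ((homothetyJacobian n 1 : ℂ)⁻¹ *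
    K (homothety q (1 : ℝ)⁻¹ z) (homothety q (1 : ℝ)⁻¹ w)) := by
    simp [hJ1, homothety_one]
  rw [e]
  exact this.tendsto

theorem tendsto_kernel (h : KernelConvergence d q D φ K Dj φj Kj) {z w : Fin n → ℂ}
    (hz : z ∈ D) (hw : w ∈ D) : Tendsto (fun j => Kj j z w) atTop (𝓝 (K z w)) := by
  rw [Metric.tendsto_nhds]
  intro ε hε
  set A := (K z z).re + 1
  have hA : 0 < A := add_pos_of_nonneg_of_pos (h.kernel.self_re_nonneg h.isOpen h.weight hz) one_pos
  -- `A` will bound `K_j(z, z)`. One `δ` pays for `K_j(w, w) < K(w, w) + δ`, the other for the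
  -- dilated kernel exceeding `K(w, w) - δ` at `w`; `norm_sq_sub_le` then compares the two kernels
  -- at `(z, w)`.
  obtain ⟨δ, hδ, hAδ⟩ : ∃ δ > 0, A * (2 * δ) < (ε / 2) ^ 2 :=
    ⟨ε ^ 2 / (16 * A), by positivity, by field_simp; norm_num⟩
  have hzw := tendsto_dilated_kernel (d := d) (q := q) h.isOpen h.weight h.kernel hz hw
  have hww := (Complex.continuous_re.tendsto _).comp
    (tendsto_dilated_kernel (d := d) (q := q) h.isOpen h.weight h.kernel hw hw)
  obtain ⟨t, ⟨ht1, ht2⟩, ht⟩ := (((Metric.tendsto_nhds.1 hzw (ε / 2) (half_pos hε)).and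
    (hww.eventually_const_lt (sub_lt_self _ hδ))).and self_mem_nhdsWithin).exists
  have ht : 1 < t := ht
  have ht0 : 0 < t := one_pos.trans ht
  have hJ := pow_pos (homothetyJacobian_pos (n := n) ht0) d
  have hcont := (differentiable_homothety q t⁻¹).continuous
  have hw' : IsContinuousWeight (homothety q t⁻¹ ⁻¹' D) (fun z => φ (homothety q t⁻¹ z)) :=
    ⟨h.weight.continuousOn.comp hcont.continuousOn fun _ hz => hz, fun z hz => h.weight.pos _ hz⟩
  have hk := (h.kernel.homothety q h.isOpen ht0).const_mul hJ
  filter_upwards [h.dilation t ht, h.weight_seq, h.kernel_seq, h.eventually_self_re_lt hz one_pos,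
    h.eventually_self_re_lt hw hδ, h.exhausts {z, w} (by simp)
    (by rintro x (rfl | rfl); exacts [hz, hw])] with j h1 h2 h3 h4 h5 h6
  have hzj : z ∈ Dj j := h6 (by simp)
  have hwj : w ∈ Dj j := h6 (by simp)
  have key := hk.norm_sq_sub_le (h.isOpen.preimage hcont) (hw'.const_mul hJ) (h.isOpen_seq j) h2 h3
    h1.1 h1.2 hzj hwj
  simp only [Function.comp_apply] at ht2
  have hnn := h3.self_re_nonneg (h.isOpen_seq j) h2 hzj
  set M := ((homothetyJacobian n t ^ d : ℝ) : ℂ)⁻¹ *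
      (((homothetyJacobian n t)⁻¹ : ℂ) * K (homothety q t⁻¹ z) (homothety q t⁻¹ w))
  have hM : ‖M - Kj j z w‖ < ε / 2 := by
    refine lt_of_pow_lt_pow_left₀ 2 (by positivity) ((key.trans ?_).trans_lt hAδ)
    exact (mul_le_mul_of_nonneg_left (by linarith) hnn).trans
      (mul_le_mul_of_nonneg_right h4.le (by positivity))
  calc dist (Kj j z w) (K z w) ≤ dist (Kj j z w) M + dist M (K z w) := dist_triangle _ _ _
    _ < ε / 2 + ε / 2 := by
      rw [dist_comm (Kj j z w), dist_eq_norm M (Kj j z w)]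
      exact add_lt_add hM ht1
    _ = ε := add_halves ε

/-- In the variables `(z, w̄)` the kernels are holomorphic and, by `norm_sq_kernel_le`, bounded by
`√(C₁ C₂)`; so pointwise convergence suffices. -/
theorem tendstoUniformlyOn_conjSnd (h : KernelConvergence d q D φ K Dj φj Kj) (m : ℕ)
    {z w : Fin n → ℂ} (hz : z ∈ D) (hw : star w ∈ D) : ∃ s > 0, TendstoUniformlyOn
      (fun j => iteratedFDeriv ℝ m
        (fun p : (Fin n → ℂ) × (Fin n → ℂ) => Kj j p.1 (star p.2) - K p.1 (star p.2)))
      0 atTop (ball (z, w) s) := by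
  obtain ⟨r₁, hr₁, C₁, hC₁, hs₁, hb₁⟩ := h.exists_eventually_self_re_le hz
  obtain ⟨r₂, hr₂, C₂, hC₂, hs₂, hb₂⟩ := h.exists_eventually_self_re_le hw
  obtain ⟨r, hr, h1, h2⟩ : ∃ r > 0, 2 * r ≤ r₁ ∧ 2 * r ≤ r₂ :=
    ⟨min r₁ r₂ / 2, by positivity, by linarith [min_le_left r₁ r₂], by linarith [min_le_right r₁ r₂]⟩
  have hmem : ∀ p ∈ ball (z, w) (2 * r), p.1 ∈ ball z r₁ ∧ star p.2 ∈ ball (star w) r₂ := by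
    intro p hp
    rw [← ball_prod_same] at hp
    refine ⟨ball_subset_ball h1 hp.1, ?_⟩
    have := hp.2
    rw [mem_ball, dist_eq_norm] at this ⊢
    rw [← star_sub, norm_star]
    linarith
  have hhol : ∀ᶠ j in atTop, DifferentiableOn ℂ (fun p : (Fin n → ℂ) × (Fin n → ℂ) =>
      Kj j p.1 (star p.2)) (ball (z, w) (2 * r)) := by
    filter_upwards [hb₁, hb₂, h.weight_seq, h.kernel_seq] with j h3 h4 h5 h6 p hp
    exact (h6.differentiableAt_conjSnd (h.isOpen_seq j) h5 (h3.1 (hmem p hp).1)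
      (h4.1 (hmem p hp).2)).differentiableWithinAt
  have hlim := tendstoUniformlyOn_ball_of_bound (C := √(C₁ * C₂)) hr hhol (g := fun p =>
    K p.1 (star p.2)) ?_ ?_
  · refine tendstoUniformlyOn_iteratedFDeriv_ball m (half_pos hr) ?_ ?_
    · filter_upwards [hhol] with j hj
      refine (hj.mono (ball_subset_ball (by linarith))).sub fun p hp => ?_
      have := hmem p (ball_subset_ball (by linarith) hp)
      exact (h.kernel.differentiableAt_conjSnd h.isOpen h.weight (hs₁ this.1)
        (hs₂ this.2)).differentiableWithinAt
    · rw [Metric.tendstoUniformlyOn_iff] at hlim ⊢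
      intro ε hε
      filter_upwards [hlim ε hε] with j hj p hp
      rw [Pi.zero_apply, dist_zero_left, ← dist_eq_norm, dist_comm]
      exact hj p hp
  · filter_upwards [hb₁, hb₂, h.weight_seq, h.kernel_seq] with j h3 h4 h5 h6 p hp
    have hp' := hmem p hp
    refine Real.le_sqrt_of_sq_le ((h6.norm_sq_kernel_le (h.isOpen_seq j) h5 (h3.1 hp'.1)
      (h4.1 hp'.2)).trans ?_)
    exact mul_le_mul (h3.2 _ hp'.1) (h4.2 _ hp'.2)
      (h6.self_re_nonneg (h.isOpen_seq j) h5 (h4.1 hp'.2)) hC₁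
  · intro p hp
    have hp' := hmem p (ball_subset_ball (by linarith) hp)
    exact h.tendsto_kernel (hs₁ hp'.1) (hs₂ hp'.2)

/-- The kernels converge locally uniformly with all derivatives. -/
theorem tendstoUniformlyOn_iteratedFDeriv (h : KernelConvergence d q D φ K Dj φj Kj) (m : ℕ)
    {S : Set ((Fin n → ℂ) × (Fin n → ℂ))} (hS : IsCompact S) (hSD : S ⊆ D ×ˢ D) :
    TendstoUniformlyOn
      (fun j => iteratedFDeriv ℝ m (fun p : (Fin n → ℂ) × (Fin n → ℂ) => Kj j p.1 p.2))
      (iteratedFDeriv ℝ m (fun p : (Fin n → ℂ) × (Fin n → ℂ) => K p.1 p.2)) atTop S := by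
  rw [← tendstoLocallyUniformlyOn_iff_tendstoUniformlyOn_of_compact hS,
    Metric.tendstoLocallyUniformlyOn_iff]
  intro ε hε p hp
  obtain ⟨s, hs, hlim⟩ := h.tendstoUniformlyOn_conjSnd m (z := p.1) (w := star p.2) (hSD hp).1
    (by rw [star_star]; exact (hSD hp).2)
  obtain ⟨r₁, hr₁, C₁, -, hs₁, hb₁⟩ := h.exists_eventually_self_re_le (hSD hp).1
  obtain ⟨r₂, hr₂, C₂, -, hs₂, hb₂⟩ := h.exists_eventually_self_re_le (hSD hp).2
  refine ⟨(conjSnd n ⁻¹' ball (p.1, star p.2) s) ∩ (ball p.1 r₁ ×ˢ ball p.2 r₂),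
    mem_nhdsWithin_of_mem_nhds (inter_mem ?_ ?_), ?_⟩
  · exact (conjSnd n).continuous.continuousAt.preimage_mem_nhds (ball_mem_nhds _ hs)
  · exact prod_mem_nhds (ball_mem_nhds _ hr₁) (ball_mem_nhds _ hr₂)
  · filter_upwards [Metric.tendstoUniformlyOn_iff.1 hlim ε hε, hb₁, hb₂, h.weight_seq,
      h.kernel_seq] with j hj h1 h2 h3 h4 x hx
    have hxD : D ×ˢ D ∈ 𝓝 x := (h.isOpen.prod h.isOpen).mem_nhds ⟨hs₁ hx.2.1, hs₂ hx.2.2⟩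
    have hxj : Dj j ×ˢ Dj j ∈ 𝓝 x :=
      ((h.isOpen_seq j).prod (h.isOpen_seq j)).mem_nhds ⟨h1.1 hx.2.1, h2.1 hx.2.2⟩
    have hm : (m : WithTop ℕ∞) ≤ ∞ := by exact_mod_cast le_top
    have c1 := (((h4.contDiffOn (h.isOpen_seq j) h3).contDiffAt hxj).of_le hm)
    have c2 := (((h.kernel.contDiffOn h.isOpen h.weight).contDiffAt hxD).of_le hm)
    have hj := hj _ hx.1
    -- `conjSnd` is a real-linear isometry, so undoing the conjugation keeps the norms of the
    -- derivatives.
    rw [Pi.zero_apply, dist_zero_left,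
      ← (conjSnd n).norm_iteratedFDeriv_comp_right] at hj
    rw [dist_comm, dist_eq_norm, ← iteratedFDeriv_sub_apply c1 c2]
    have e : (fun p : (Fin n → ℂ) × (Fin n → ℂ) => Kj j p.1 (star p.2) - K p.1 (star p.2)) ∘
        conjSnd n = (fun p => Kj j p.1 p.2) - fun p => K p.1 p.2 := by
      funext y
      simp
    rwa [e] at hj

theorem tendstoUniformlyOn_self_re (h : KernelConvergence d q D φ K Dj φj Kj)
    {S : Set (Fin n → ℂ)} (hS : IsCompact S) (hSD : S ⊆ D) :
    TendstoUniformlyOn (fun j z => (Kj j z z).re) (fun z => (K z z).re) atTop S := by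
  have h0 := h.tendstoUniformlyOn_iteratedFDeriv 0 (S := (fun z => (z, z)) '' S)
    (hS.image (by fun_prop)) (by rintro _ ⟨z, hz, rfl⟩; exact ⟨hSD hz, hSD hz⟩)
  rw [Metric.tendstoUniformlyOn_iff] at h0 ⊢
  intro ε hε
  filter_upwards [h0 ε hε] with j hj z hz
  have := hj _ ⟨z, hz, rfl⟩
  rw [iteratedFDeriv_zero_eq_comp, iteratedFDeriv_zero_eq_comp, Function.comp_apply,
    Function.comp_apply, LinearIsometryEquiv.dist_map] at this
  refine lt_of_le_of_lt ?_ this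
  rw [dist_eq_norm, dist_eq_norm, ← Complex.sub_re]
  exact Complex.abs_re_le_norm _

end KernelConvergence

end Convergence

/-! ### The weights `K_D^{-d}` -/

section BergmanWeight

variable {n : ℕ} {D : Set (Fin n → ℂ)}

theorem isContinuousWeight_one (D : Set (Fin n → ℂ)) : IsContinuousWeight D (fun _ => 1) :=
  ⟨continuousOn_const, fun _ _ => one_pos⟩

theorem isReproducingKernel_bergmanKernel (hD : IsOpen D) :
    IsReproducingKernel D (fun _ => 1) (bergmanKernel D) :=
  isReproducingKernel_weightedBergmanKernel hD (isContinuousWeight_one D)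

theorem bergmanKernel_self_re_nonneg (hD : IsOpen D) {z : Fin n → ℂ} (hz : z ∈ D) :
    0 ≤ (bergmanKernel D z z).re :=
  (isReproducingKernel_bergmanKernel hD).self_re_nonneg hD (isContinuousWeight_one D) hz

theorem bergmanKernel_self_re_pos_iff (hD : IsOpen D) {z : Fin n → ℂ} (hz : z ∈ D) :
    0 < (bergmanKernel D z z).re ↔ bergmanKernel D z z ≠ 0 := by
  rw [(bergmanKernel_self_re_nonneg hD hz).lt_iff_ne',
    (isReproducingKernel_bergmanKernel hD).self_eq hz, Complex.ofReal_re, Ne, Ne,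
    Complex.ofReal_eq_zero]

theorem isContinuousWeight_bergmanWeight (hD : IsOpen D)
    (hK : ∀ z ∈ D, bergmanKernel D z z ≠ 0) (d : ℕ) : IsContinuousWeight D (bergmanWeight D d) := by
  have hpos := fun z hz => (bergmanKernel_self_re_pos_iff hD hz).2 (hK z hz)
  refine ⟨ContinuousOn.inv₀ (((isReproducingKernel_bergmanKernel hD).continuousOn_self_re hD
    (isContinuousWeight_one D)).pow d) fun z hz => (pow_pos (hpos z hz) d).ne', fun z hz => ?_⟩
  exact inv_pos.2 (pow_pos (hpos z hz) d)

theorem isReproducingKernel_bergmanKernelOfOrder (hD : IsOpen D)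
    (hK : ∀ z ∈ D, bergmanKernel D z z ≠ 0) (d : ℕ) :
    IsReproducingKernel D (bergmanWeight D d) (bergmanKernelOfOrder D d) :=
  isReproducingKernel_weightedBergmanKernel hD (isContinuousWeight_bergmanWeight hD hK d)

end BergmanWeight

/-! ### Verification of the convergence data and the main theorem -/

section DomainConvergence

variable {n : ℕ} {D : Set (Fin n → ℂ)} {Dj : ℕ → Set (Fin n → ℂ)} {q : Fin n → ℂ}

theorem eventually_subset_preimage_homothety (h_dilate : ∀ ε : ℝ, 0 < ε → ∃ j₀ : ℕ, ∀ j ≥ j₀,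
      (fun v => v - q) '' Dj j ⊆ (1 + ε) • ((fun v => v - q) '' D)) {t : ℝ} (ht : 1 < t) :
    ∀ᶠ j in atTop, Dj j ⊆ homothety q t⁻¹ ⁻¹' D := by
  obtain ⟨j₀, hj₀⟩ := h_dilate (t - 1) (sub_pos.2 ht)
  filter_upwards [eventually_ge_atTop j₀] with j hj z hz
  obtain ⟨-, ⟨v, hv, rfl⟩, hvz⟩ := hj₀ j hj ⟨z, hz, rfl⟩
  simp only [add_sub_cancel] at hvz
  rw [Set.mem_preimage, homothety, ← hvz, inv_smul_smul₀ (one_pos.trans ht).ne', add_sub_cancel]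
  exact hv

/-- The left side is the Bergman kernel of the dilate of `D`, which contains `D'`. -/
theorem inv_homothetyJacobian_mul_le (hD : IsOpen D) {D' : Set (Fin n → ℂ)} (hD' : IsOpen D')
    {t : ℝ} (ht : 0 < t) (h : D' ⊆ homothety q t⁻¹ ⁻¹' D) {z : Fin n → ℂ} (hz : z ∈ D') :
    (homothetyJacobian n t)⁻¹ * (bergmanKernel D (homothety q t⁻¹ z) (homothety q t⁻¹ z)).re ≤
      (bergmanKernel D' z z).re := by
  have := ((isReproducingKernel_bergmanKernel hD).homothety q hD ht).self_re_le
    (hD.preimage (differentiable_homothety q t⁻¹).continuous) (isContinuousWeight_one _) hD'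
    (isContinuousWeight_one _) (isReproducingKernel_bergmanKernel hD') h (fun _ _ => le_rfl) hz
  rwa [← Complex.ofReal_inv, Complex.re_ofReal_mul] at this

theorem kernelConvergence_bergmanKernel (hD : IsOpen D) (hDj : ∀ j, IsOpen (Dj j))
    (h_compact : ∀ S : Set (Fin n → ℂ), IsCompact S → S ⊆ D → ∀ᶠ j in atTop, S ⊆ Dj j)
    (h_dilate : ∀ ε : ℝ, 0 < ε → ∃ j₀ : ℕ, ∀ j ≥ j₀,
      (fun v => v - q) '' Dj j ⊆ (1 + ε) • ((fun v => v - q) '' D)) :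
    KernelConvergence 0 q D (fun _ => 1) (bergmanKernel D) Dj (fun _ _ => 1)
      (fun j => bergmanKernel (Dj j)) where
  isOpen := hD
  weight := isContinuousWeight_one D
  kernel := isReproducingKernel_bergmanKernel hD
  isOpen_seq := hDj
  weight_seq := Eventually.of_forall fun _ => isContinuousWeight_one _
  kernel_seq := Eventually.of_forall fun j => isReproducingKernel_bergmanKernel (hDj j)
  exhausts := h_compact
  weight_le := fun S _ _ c _ hc => Eventually.of_forall fun j z _ => by linarith
  dilation := fun t ht => by
    filter_upwards [eventually_subset_preimage_homothety h_dilate ht] with j hj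
    exact ⟨hj, fun z _ => by simp⟩

/-- Nonvanishing is needed on all of `D_j`, beyond the reach of convergence on compact sets; the
outer inclusion, with ratio `2` as a convenient choice, gives it globally. -/
theorem eventually_bergmanKernel_ne_zero (hD : IsOpen D) (hDj : ∀ j, IsOpen (Dj j))
    (h_dilate : ∀ ε : ℝ, 0 < ε → ∃ j₀ : ℕ, ∀ j ≥ j₀,
      (fun v => v - q) '' Dj j ⊆ (1 + ε) • ((fun v => v - q) '' D))
    (hK : ∀ z ∈ D, bergmanKernel D z z ≠ 0) :
    ∀ᶠ j in atTop, ∀ z ∈ Dj j, bergmanKernel (Dj j) z z ≠ 0 := by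
  filter_upwards [eventually_subset_preimage_homothety h_dilate one_lt_two] with j hj z hz
  rw [← bergmanKernel_self_re_pos_iff (hDj j) hz]
  refine lt_of_lt_of_le ?_ (inv_homothetyJacobian_mul_le hD (hDj j) two_pos hj hz)
  exact mul_pos (inv_pos.2 (homothetyJacobian_pos two_pos))
    ((bergmanKernel_self_re_pos_iff hD (hj hz)).2 (hK _ (hj hz)))

theorem kernelConvergence_bergmanKernelOfOrder (d : ℕ) (hD : IsOpen D) (hDj : ∀ j, IsOpen (Dj j))
    (h_compact : ∀ S : Set (Fin n → ℂ), IsCompact S → S ⊆ D → ∀ᶠ j in atTop, S ⊆ Dj j)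
    (h_dilate : ∀ ε : ℝ, 0 < ε → ∃ j₀ : ℕ, ∀ j ≥ j₀,
      (fun v => v - q) '' Dj j ⊆ (1 + ε) • ((fun v => v - q) '' D))
    (hK : ∀ z ∈ D, bergmanKernel D z z ≠ 0) :
    KernelConvergence d q D (bergmanWeight D d) (bergmanKernelOfOrder D d) Dj
      (fun j => bergmanWeight (Dj j) d) (fun j => bergmanKernelOfOrder (Dj j) d) where
  isOpen := hD
  weight := isContinuousWeight_bergmanWeight hD hK d
  kernel := isReproducingKernel_bergmanKernelOfOrder hD hK d
  isOpen_seq := hDj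
  weight_seq := (eventually_bergmanKernel_ne_zero hD hDj h_dilate hK).mono fun j hj =>
    isContinuousWeight_bergmanWeight (hDj j) hj d
  kernel_seq := (eventually_bergmanKernel_ne_zero hD hDj h_dilate hK).mono fun j hj =>
    isReproducingKernel_bergmanKernelOfOrder (hDj j) hj d
  exhausts := h_compact
  weight_le := fun S hS hSD c hc hc1 => by
    rcases S.eq_empty_or_nonempty with rfl | hne
    · simp
    have hKD : ContinuousOn (fun z => (bergmanKernel D z z).re) S :=
      ((isReproducingKernel_bergmanKernel hD).continuousOn_self_re hD
        (isContinuousWeight_one D)).mono hSD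
    obtain ⟨z₀, hz₀, hmin⟩ := hS.exists_isMinOn hne hKD
    set m₀ := (bergmanKernel D z₀ z₀).re
    have hm₀ : 0 < m₀ := (bergmanKernel_self_re_pos_iff hD (hSD hz₀)).2 (hK _ (hSD hz₀))
    -- Uniform convergence on `S` with tolerance `(b - 1) m₀` yields `K_{D_j} ≤ b K_D` there; the
    -- weights then lose at most the factor `b ^ d`, and `c ≤ b^{-d}`.
    obtain ⟨b, hb, hb1⟩ : ∃ b : ℝ, c * b ^ d < 1 ∧ 1 < b := by
      have hlim : Tendsto (fun b : ℝ => c * b ^ d) (𝓝[>] 1) (𝓝 (c * 1 ^ d)) := by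
        have : Continuous fun b : ℝ => c * b ^ d := by fun_prop
        exact (this.tendsto 1).mono_left nhdsWithin_le_nhds
      rw [one_pow, mul_one] at hlim
      exact ((hlim.eventually_lt_const hc1).and self_mem_nhdsWithin).exists
    have hunif := (kernelConvergence_bergmanKernel hD hDj h_compact
      h_dilate).tendstoUniformlyOn_self_re hS hSD
    filter_upwards [Metric.tendstoUniformlyOn_iff.1 hunif ((b - 1) * m₀)
      (mul_pos (sub_pos.2 hb1) hm₀), h_compact S hS hSD,
      eventually_bergmanKernel_ne_zero hD hDj h_dilate hK] with j hj hSj hne z hz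
    have h1 := hj z hz
    rw [Real.dist_eq] at h1
    have h2 : m₀ ≤ (bergmanKernel D z z).re := hmin hz
    have hpos := (bergmanKernel_self_re_pos_iff (hDj j) (hSj hz)).2 (hne z (hSj hz))
    have hle : (bergmanKernel (Dj j) z z).re ≤ b * (bergmanKernel D z z).re := by
      have := neg_le_abs ((bergmanKernel D z z).re - (bergmanKernel (Dj j) z z).re)
      nlinarith [mul_le_mul_of_nonneg_left h2 (sub_pos.2 hb1).le]
    have hposD := pow_pos (hm₀.trans_le h2) d
    have hpow := pow_le_pow_left₀ hpos.le hle d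
    rw [mul_pow] at hpow
    rw [bergmanWeight, bergmanWeight, mul_inv_le_iff₀ hposD, inv_mul_eq_div,
      le_div_iff₀ (pow_pos hpos d)]
    calc c * (bergmanKernel (Dj j) z z).re ^ d
        ≤ c * (b ^ d * (bergmanKernel D z z).re ^ d) := mul_le_mul_of_nonneg_left hpow hc.le
      _ = c * b ^ d * (bergmanKernel D z z).re ^ d := by ring
      _ ≤ (bergmanKernel D z z).re ^ d := mul_le_of_le_one_left hposD.le hb.le
  dilation := fun t ht => by
    have ht0 : 0 < t := one_pos.trans ht
    filter_upwards [eventually_subset_preimage_homothety h_dilate ht] with j hj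
    refine ⟨hj, fun z hz => ?_⟩
    have hle := inv_homothetyJacobian_mul_le hD (hDj j) ht0 hj hz
    have hpos := (bergmanKernel_self_re_pos_iff hD (hj hz)).2 (hK _ (hj hz))
    have hJ := homothetyJacobian_pos (n := n) ht0
    have hpos' := mul_pos (inv_pos.2 hJ) hpos
    -- Inverting the `d`-th power of the lower bound for `K_{D_j}` produces the factor `J ^ d` that
    -- the field `dilation` allows.
    calc bergmanWeight (Dj j) d z ≤ (((homothetyJacobian n t)⁻¹ *
          (bergmanKernel D (homothety q t⁻¹ z) (homothety q t⁻¹ z)).re) ^ d)⁻¹ :=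
          inv_anti₀ (pow_pos hpos' d) (pow_le_pow_left₀ hpos'.le hle d)
      _ = _ := by rw [mul_pow, mul_inv, inv_pow, inv_inv, bergmanWeight]

end DomainConvergence

/- Derivatives of all orders `m` are taken with respect to all real variables of `ℂⁿ × ℂⁿ`;
`m = 0` is the convergence of the kernels themselves. -/
theorem proposition4p1 (n d : ℕ) (D : Set (Fin n → ℂ)) (Dj : ℕ → Set (Fin n → ℂ))
    (hD : IsOpen D) (hD' : IsConnected D)
    (hDj : ∀ j, IsOpen (Dj j)) (hDj' : ∀ j, IsConnected (Dj j))
    (h_compact : ∀ S : Set (Fin n → ℂ), IsCompact S → S ⊆ D → ∀ᶠ j in atTop, S ⊆ Dj j)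
    (q : Fin n → ℂ) (hq : q ∈ D) (hqj : ∀ j, q ∈ Dj j)
    (h_dilate : ∀ ε : ℝ, 0 < ε → ∃ j₀ : ℕ, ∀ j ≥ j₀,
      (fun v => v - q) '' Dj j ⊆ (1 + ε) • ((fun v => v - q) '' D))
    (h_star : StarConvex ℝ q D)
    (hK : ∀ z ∈ D, bergmanKernel D z z ≠ 0)
    (hKd : ∀ z ∈ D, bergmanKernelOfOrder D d z z ≠ 0) :
    -- the objects in the limit relation are meaningful: for large `j` the weight of `D_j` is
    -- well defined, the reproducing kernel exists, and all kernels are smooth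
    (∀ᶠ j in atTop, (∀ z ∈ Dj j, bergmanKernel (Dj j) z z ≠ 0) ∧
      IsReproducingKernel (Dj j) (bergmanWeight (Dj j) d) (bergmanKernelOfOrder (Dj j) d) ∧
      ContDiffOn ℝ ∞ (fun p : (Fin n → ℂ) × (Fin n → ℂ) => bergmanKernelOfOrder (Dj j) d p.1 p.2)
        (Dj j ×ˢ Dj j)) ∧
    ContDiffOn ℝ ∞ (fun p : (Fin n → ℂ) × (Fin n → ℂ) => bergmanKernelOfOrder D d p.1 p.2)
      (D ×ˢ D) ∧
    -- uniform convergence on compact subsets, with all derivatives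
    ∀ (m : ℕ) (S : Set ((Fin n → ℂ) × (Fin n → ℂ))), IsCompact S → S ⊆ D ×ˢ D →
      TendstoUniformlyOn
        (fun j => iteratedFDeriv ℝ m
          (fun p : (Fin n → ℂ) × (Fin n → ℂ) => bergmanKernelOfOrder (Dj j) d p.1 p.2))
        (iteratedFDeriv ℝ m
          (fun p : (Fin n → ℂ) × (Fin n → ℂ) => bergmanKernelOfOrder D d p.1 p.2))
        atTop S := by
  have hconv := kernelConvergence_bergmanKernelOfOrder d hD hDj h_compact h_dilate hK
  refine ⟨?_, hconv.kernel.contDiffOn hD hconv.weight,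
    fun m S hS hSD => hconv.tendstoUniformlyOn_iteratedFDeriv m hS hSD⟩
  filter_upwards [eventually_bergmanKernel_ne_zero hD hDj h_dilate hK, hconv.weight_seq,
    hconv.kernel_seq] with j h1 h2 h3
  exact ⟨h1, h3, h3.contDiffOn (hDj j) h2⟩
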